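/- Notation: $\mathbb{R}_+=[0,\infty)$, $\mathbb{R}_-=(-\infty,0]$, $\mathbb{C}_+=\{z\in\mathbb{C}:\operatorname{Re}z\ge 0\}$, $\mathbb{C}_-=\{z\in\mathbb{C}:\operatorname{Re}z\le 0\}$. Let $b\in\mathbb{R}$, $c>0$, $\rho\in[-1,1]$, $\Lambda\ge 0$, and let $\nu$ be a nonnegative Borel measure on $\mathbb{R}_+$ with $\nu(\{0\})=0$ and $\int_{\mathbb{R}_+}z^2\,\nu(\mathrm{d}z)<\infty$. Define $F\colon\mathbb{C}_+\times\mathbb{C}_-\to\mathbb{C}$ by $$F(u,v)=\tfrac12(u^2-u)+(b+\rho\sqrt{c}\,u)\,v+\tfrac{c}{2}v^2+\int_{\mathbb{R}_+}\Big[e^{(v-\Lambda u)z}-u\,(e^{-\Lambda z}-1)-1-vz\Big]\nu(\mathrm{d}z).$$ Let the kernel $K\in L^2_{\mathrm{loc}}(\mathbb{R}_+;\mathbb{R})$ be nonnegative, nonincreasing, not identically zero and continuously differentiable on $(0,\infty)$. Suppose that $K$ has a resolvent of the first kind $L$ (a locally finite measure on $\mathbb{R}_+$ with $\int_{[0,t]}K(t-s)\,L(\mathrm{d}s)=1$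 for almost every $t>0$) which is nonnegative and nonincreasing, the latter meaning that $s\mapsto L([s,s+t])$ is nonincreasing on $\mathbb{R}_+$ for every $t\ge 0$. Let $w\in\mathbb{C}$ with $\operatorname{Re}w\in[0,1]$. Then: (i) There exists a unique continuous function $\psi_w\colon\mathbb{R}_+\to\mathbb{C}_-$ solving the Riccati–Volterra equation $$\psi_w(t)=\int_0^t K(t-s)\,F(w,\psi_w(s))\,\mathrm{d}s,\qquad t\ge 0.$$ In particular this holds with $w$ replaced by $\operatorname{Re}w$, and the corresponding solution $\psi_{\operatorname{Re}w}$ is $\mathbb{R}_-$-valued. (ii) For every $t\ge 0$, $$\operatorname{Re}\psi_w(t)\le\psi_{\operatorname{Re}w}(t)\le 0.$$ -/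

import Mathlib

open MeasureTheory Set

/-- A nonnegative measure `L` on `ℝ₊ = [0, ∞)`, finite on compact sets, is a resolvent of the first
kind of the scalar kernel `K` if `(K ∗ L)(t) = ∫_{[0,t]} K(t - s) L(ds) = 1` for a.e. `t > 0`
(scalar convolution is commutative, so `L ∗ K = K ∗ L`).
A measure on `ℝ₊` is modelled by a measure on `ℝ` that does not charge `(-∞, 0)`. If the integral is
not absolutely convergent, its value in Lean is `0 ≠ 1`, so convergence is part of the equation. -/
structure IsNonnegResolventFirstKind (K : ℝ → ℝ) (L : Measure ℝ) : Prop where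
  support_nonneg : L (Iio 0) = 0
  finite_on_compacts : ∀ T : ℝ, L (Icc 0 T) < ⊤
  conv_eq_one : ∀ᵐ t ∂(volume.restrict (Ioi (0 : ℝ))), ∫ s in Icc 0 t, K (t - s) ∂L = 1

/-- The standing hypothesis on the kernel. Only the values of `K` on `(0, ∞)` matter. -/
structure KernelHypothesis (K : ℝ → ℝ) : Prop where
  memL2_loc : ∀ T : ℝ, MemLp K 2 (volume.restrict (Icc 0 T))
  nonneg : ∀ t : ℝ, 0 < t → 0 ≤ K t
  nonincreasing : AntitoneOn K (Ioi 0)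
  not_zero : ∃ t : ℝ, 0 < t ∧ K t ≠ 0
  contDiff : ContDiffOn ℝ 1 K (Ioi 0)
  /-- The resolvent of the first kind exists, is nonnegative, and is nonincreasing:
  `s ↦ L[s, s + t]` is nonincreasing on `ℝ₊` for every `t ≥ 0`. -/
  resolvent : ∃ L : Measure ℝ, IsNonnegResolventFirstKind K L ∧
    ∀ t : ℝ, 0 ≤ t → AntitoneOn (fun s : ℝ => L (Icc s (s + t))) (Ici 0)

/-- The function
`F(u,v) = (u² - u)/2 + (b + ρ√c u) v + (c/2) v²
  + ∫ [e^{(v - Λu) z} - u (e^{-Λz} - 1) - 1 - v z] ν(dz)`.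
For `Re u ≥ 0`, `Re v ≤ 0`, `Λ ≥ 0` and `ν` carried by `(0, ∞)` with `∫ z² ν(dz) < ∞`, the integrand
is bounded by a constant times `z²`, so the integral converges absolutely. -/
noncomputable def riccatiF (b c ρ Λ : ℝ) (ν : Measure ℝ) (u v : ℂ) : ℂ :=
  (1 / 2) * (u ^ 2 - u) + ((b : ℂ) + (ρ : ℂ) * (Real.sqrt c : ℂ) * u) * v + ((c : ℂ) / 2) * v ^ 2
    + ∫ z : ℝ, (Complex.exp ((v - (Λ : ℂ) * u) * (z : ℂ))
        - u * (Complex.exp (-(Λ : ℂ) * (z : ℂ)) - 1) - 1 - v * (z : ℂ)) ∂ν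

/-- `ψ`, restricted to `ℝ₊`, is a continuous solution with values in
`ℂ₋ = {v | Re v ≤ 0}` of `ψ(t) = ∫₀ᵗ K(t - s) F(w, ψ(s)) ds`, `t ≥ 0`.
The values of `ψ` on the negative half-line are irrelevant. -/
structure IsRiccatiVolterraSolution (b c ρ Λ : ℝ) (ν : Measure ℝ) (K : ℝ → ℝ) (w : ℂ)
    (ψ : ℝ → ℂ) : Prop where
  continuousOn : ContinuousOn ψ (Ici 0)
  re_nonpos : ∀ t : ℝ, 0 ≤ t → (ψ t).re ≤ 0
  equation : ∀ t : ℝ, 0 ≤ t →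
    ψ t = ∫ s in (0 : ℝ)..t, ((K (t - s) : ℝ) : ℂ) * riccatiF b c ρ Λ ν w (ψ s)

/-! The analytic core is an extremum principle. Suppose `f = K ∗ P` has a nonpositive minimum over
`[0, t]` at its right end. Convolving with the resolvent turns `f` into the primitive of `P`.
Comparing this identity at `t` and `t - δ`, the monotonicity of `L` absorbs the shifted mass and
leaves `∫ P` over `[t - δ, t]` bounded by `o(δ)`, so `P t ≤ 0` (`nonpos_of_volterra_isMin`).
Polynomial approximation removes the smoothness of `P`, and an exponential perturbation gives the
comparison principle `VolterraKernel.neg_le_volterra`: `K ∗ h` stays above `-c` if, below that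
level, `h ≥ M (K ∗ h + c)`.

Every sign statement is an instance. `F(w, ·)` points into the left half-plane along the imaginary
axis, so solutions stay in it. There `Re F(w, v) ≤ F(Re w, Re v)`, because `cos ≤ 1` and `|ρ| ≤ 1`;
with the Lipschitz bound this yields `Re ψ_w ≤ ψ_{Re w}`.

Global existence needs a priori bounds, since `F` is quadratic. For `Re v ≤ 0` the dangerous term `c
Re v Im v` in `Im F` has a damping sign, so `|Im ψ|` is bounded by comparison. Once `Im ψ` is
bounded, `(c/2)(Re v)²` helps and `Re F` decreases at most linearly, so Gronwall bounds `Re ψ`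
below. Hence `F` may be truncated to a large box, where it is Lipschitz and the fixed point theorem
applies, and the solution never feels the truncation. Uniqueness is Gronwall; conjugating a solution
for real `w` shows that it is real. -/

/-- The Volterra convolution `(K ∗ h)(t) = ∫₀ᵗ K(t - s) h(s) ds`. -/
noncomputable def volterra {E : Type*} [NormedAddCommGroup E] [NormedSpace ℝ E]
    (K : ℝ → ℝ) (h : ℝ → E) (t : ℝ) : E :=
  ∫ s in (0 : ℝ)..t, K (t - s) • h s

/-! ### Convolution with an integrable kernel: continuity, Gronwall, Lipschitz equations. -/

section Volterra

variable {E : Type*} [NormedAddCommGroup E] [NormedSpace ℝ E] {K : ℝ → ℝ}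

theorem volterra_eq_integral_comp_sub (K : ℝ → ℝ) (h : ℝ → E) (t : ℝ) :
    volterra K h t = ∫ s in (0 : ℝ)..t, K s • h (t - s) := by
  have := intervalIntegral.integral_comp_sub_left (a := 0) (b := t) (fun s => K s • h (t - s)) t
  simpa [volterra] using this

theorem volterra_zero (K : ℝ → ℝ) (h : ℝ → E) : volterra K h 0 = 0 := by
  simp [volterra]

theorem intervalIntegrable_kernel (hK : ∀ T, IntegrableOn K (Ioc 0 T)) {t : ℝ} (ht : 0 ≤ t) :
    IntervalIntegrable K volume 0 t :=
  (intervalIntegrable_iff_integrableOn_Ioc_of_le ht).2 (hK t)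

theorem intervalIntegrable_kernel_sub (hK : ∀ T, IntegrableOn K (Ioc 0 T)) {t : ℝ} (ht : 0 ≤ t) :
    IntervalIntegrable (fun s => K (t - s)) volume 0 t := by
  simpa using ((intervalIntegrable_kernel hK ht).comp_sub_left t).symm

theorem intervalIntegrable_volterra (hK : ∀ T, IntegrableOn K (Ioc 0 T)) {h : ℝ → E} {t : ℝ}
    (ht : 0 ≤ t) (hh : ContinuousOn h (Icc 0 t)) :
    IntervalIntegrable (fun s => K (t - s) • h s) volume 0 t :=
  (intervalIntegrable_kernel_sub hK ht).smul_continuousOn (by rwa [uIcc_of_le ht])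

theorem volterra_congr {h g : ℝ → E} {t : ℝ} (ht : 0 ≤ t) (hg : EqOn h g (Icc 0 t)) :
    volterra K h t = volterra K g t := by
  refine intervalIntegral.integral_congr fun s hs => ?_
  rw [uIcc_of_le ht] at hs
  simp only [hg hs]

theorem volterra_sub (hK : ∀ T, IntegrableOn K (Ioc 0 T)) {h g : ℝ → E} {t : ℝ} (ht : 0 ≤ t)
    (hh : ContinuousOn h (Icc 0 t)) (hg : ContinuousOn g (Icc 0 t)) :
    volterra K (fun s => h s - g s) t = volterra K h t - volterra K g t := by
  simp only [volterra, smul_sub]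
  exact intervalIntegral.integral_sub (intervalIntegrable_volterra hK ht hh)
    (intervalIntegrable_volterra hK ht hg)

theorem volterra_add (hK : ∀ T, IntegrableOn K (Ioc 0 T)) {h g : ℝ → E} {t : ℝ} (ht : 0 ≤ t)
    (hh : ContinuousOn h (Icc 0 t)) (hg : ContinuousOn g (Icc 0 t)) :
    volterra K (fun s => h s + g s) t = volterra K h t + volterra K g t := by
  simp only [volterra, smul_add]
  exact intervalIntegral.integral_add (intervalIntegrable_volterra hK ht hh)
    (intervalIntegrable_volterra hK ht hg)

theorem volterra_const_mul (c : ℝ) (h : ℝ → ℝ) (t : ℝ) :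
    volterra K (fun s => c * h s) t = c * volterra K h t := by
  simp only [volterra, smul_eq_mul, ← intervalIntegral.integral_const_mul]
  congr 1; ext s; ring

theorem volterra_clm {F : Type*} [NormedAddCommGroup F] [NormedSpace ℝ F] [CompleteSpace E]
    [CompleteSpace F] (A : E →L[ℝ] F)
    (hK : ∀ T, IntegrableOn K (Ioc 0 T)) {h : ℝ → E} {t : ℝ} (ht : 0 ≤ t)
    (hh : ContinuousOn h (Icc 0 t)) :
    volterra K (fun s => A (h s)) t = A (volterra K h t) := by
  rw [volterra, volterra, ← A.intervalIntegral_comp_comm (intervalIntegrable_volterra hK ht hh)]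
  simp

theorem volterra_mono (hK : ∀ T, IntegrableOn K (Ioc 0 T)) (hK0 : ∀ t, 0 < t → 0 ≤ K t)
    {h g : ℝ → ℝ} {t : ℝ} (ht : 0 ≤ t)
    (hh : ContinuousOn h (Icc 0 t)) (hg : ContinuousOn g (Icc 0 t))
    (hle : ∀ s ∈ Icc 0 t, h s ≤ g s) : volterra K h t ≤ volterra K g t := by
  refine intervalIntegral.integral_mono_on_of_le_Ioo ht (intervalIntegrable_volterra hK ht hh)
    (intervalIntegrable_volterra hK ht hg) fun s hs => ?_
  exact mul_le_mul_of_nonneg_left (hle s (Ioo_subset_Icc_self hs)) (hK0 _ (sub_pos.2 hs.2))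

theorem norm_volterra_le (hK : ∀ T, IntegrableOn K (Ioc 0 T)) (hK0 : ∀ t, 0 < t → 0 ≤ K t)
    {h : ℝ → E} {g : ℝ → ℝ} {t : ℝ} (ht : 0 ≤ t)
    (hh : ContinuousOn h (Icc 0 t)) (hg : ContinuousOn g (Icc 0 t))
    (hle : ∀ s ∈ Icc 0 t, ‖h s‖ ≤ g s) : ‖volterra K h t‖ ≤ volterra K g t := by
  refine (intervalIntegral.norm_integral_le_integral_norm ht).trans ?_
  refine intervalIntegral.integral_mono_on_of_le_Ioo ht
    (intervalIntegrable_volterra hK ht hh).norm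
    (intervalIntegrable_volterra hK ht hg) fun s hs => ?_
  have h0 := hK0 _ (sub_pos.2 hs.2)
  rw [norm_smul, Real.norm_of_nonneg h0, smul_eq_mul]
  exact mul_le_mul_of_nonneg_left (hle s (Ioo_subset_Icc_self hs)) h0

theorem volterra_nonneg (hK0 : ∀ t, 0 < t → 0 ≤ K t) {h : ℝ → ℝ} {t : ℝ} (ht : 0 ≤ t)
    (hh : ∀ s ∈ Icc 0 t, 0 ≤ h s) : 0 ≤ volterra K h t := by
  have : ∀ᵐ s ∂volume.restrict (Ioc 0 t), 0 ≤ K (t - s) • h s := by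
    rw [← restrict_Ioo_eq_restrict_Ioc]
    filter_upwards [ae_restrict_mem measurableSet_Ioo] with s hs
    exact mul_nonneg (hK0 _ (sub_pos.2 hs.2)) (hh s (Ioo_subset_Icc_self hs))
  rw [volterra, intervalIntegral.integral_of_le ht]
  exact integral_nonneg_of_ae this

theorem volterra_one_mono (hK : ∀ T, IntegrableOn K (Ioc 0 T)) (hK0 : ∀ t, 0 < t → 0 ≤ K t)
    {s t : ℝ} (hs : 0 ≤ s) (hst : s ≤ t) :
    volterra K (fun _ => (1 : ℝ)) s ≤ volterra K (fun _ => (1 : ℝ)) t := by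
  simp only [volterra_eq_integral_comp_sub, smul_eq_mul, mul_one]
  rw [← intervalIntegral.integral_add_adjacent_intervals (intervalIntegrable_kernel hK hs)
    ((intervalIntegrable_kernel hK hs).symm.trans (intervalIntegrable_kernel hK (hs.trans hst)))]
  have : 0 ≤ ∫ x in s..t, K x := by
    rw [intervalIntegral.integral_of_le hst]
    exact setIntegral_nonneg measurableSet_Ioc fun x hx => hK0 x (hs.trans_lt hx.1)
  linarith

/-- Putting the shift on `h`, cut off at `0`, makes the domain of integration fixed. The integrand
is then continuous at `t₀` except when `s = t₀`, a null set, and dominated convergence applies. -/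
theorem continuousOn_volterra (hK : ∀ T, IntegrableOn K (Ioc 0 T)) {h : ℝ → E} {T : ℝ}
    (hT : 0 ≤ T) (hh : ContinuousOn h (Icc 0 T)) : ContinuousOn (volterra K h) (Icc 0 T) := by
  set g : ℝ → E := fun s => h (projIcc 0 T hT s) with hg
  have hgc : Continuous g := hh.comp_continuous
    (continuous_subtype_val.comp continuous_projIcc) fun s => (projIcc 0 T hT s).2
  have hgh : EqOn h g (Icc 0 T) := fun s hs => by simp [hg, projIcc_of_mem hT hs]
  obtain ⟨C, hC⟩ : ∃ C, ∀ s, ‖g s‖ ≤ C := by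
    obtain ⟨C, hC⟩ := isCompact_Icc.exists_bound_of_continuousOn hh
    exact ⟨C, fun s => hC _ (projIcc 0 T hT s).2⟩
  set H : ℝ → E := (Ioi 0).indicator g with hH
  have hHC : ∀ s, ‖H s‖ ≤ C := fun s => (norm_indicator_le_norm_self g s).trans (hC s)
  have hHm : StronglyMeasurable H := hgc.stronglyMeasurable.indicator measurableSet_Ioi
  have key : EqOn (volterra K h) (fun t => ∫ s in Ioc 0 T, K s • H (t - s)) (Icc 0 T) := by
    intro t ht
    have hsub : Ioc 0 t ⊆ Ioc 0 T := Ioc_subset_Ioc_right ht.2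
    simp only
    rw [volterra_congr ht.1 (hgh.mono (Icc_subset_Icc_right ht.2)), volterra_eq_integral_comp_sub,
      intervalIntegral.integral_of_le ht.1, integral_Ioc_eq_integral_Ioo,
      setIntegral_eq_of_subset_of_forall_sdiff_eq_zero (s := Ioo 0 t) measurableSet_Ioc
        (Ioo_subset_Ioc_self.trans hsub)]
    · refine setIntegral_congr_fun measurableSet_Ioo fun s hs => ?_
      simp [hH, indicator_of_mem (mem_Ioi.2 (sub_pos.2 hs.2))]
    · intro s hs
      have : t - s ∉ Ioi (0 : ℝ) := fun h' => hs.2 ⟨hs.1.1, sub_pos.1 h'⟩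
      simp [hH, indicator_of_notMem this]
  refine ContinuousOn.congr (Continuous.continuousOn ?_) key
  refine continuous_iff_continuousAt.2 fun t₀ => ?_
  refine continuousAt_of_dominated (bound := fun s => ‖K s‖ * C) ?_ ?_ ((hK T).norm.mul_const C) ?_
  · refine Filter.Eventually.of_forall fun t => ?_
    exact (hK T).aestronglyMeasurable.smul
      (hHm.comp_measurable (measurable_const.sub measurable_id)).aestronglyMeasurable
  · refine Filter.Eventually.of_forall fun t => Filter.Eventually.of_forall fun s => ?_
    rw [norm_smul]
    exact mul_le_mul_of_nonneg_left (hHC _) (norm_nonneg _)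
  · have : ∀ᵐ s ∂volume.restrict (Ioc 0 T), s ≠ t₀ := by
      refine ae_restrict_of_ae ?_
      simp [ae_iff, measure_singleton]
    filter_upwards [this] with s hs
    refine continuousAt_const.smul ?_
    have hne : t₀ - s ≠ 0 := sub_ne_zero.2 (Ne.symm hs)
    have hca : ContinuousAt H (t₀ - s) := by
      rcases lt_or_gt_of_ne hne with hlt | hgt
      · have : H =ᶠ[nhds (t₀ - s)] fun _ => 0 := by
          filter_upwards [Iio_mem_nhds hlt] with x hx
          exact indicator_of_notMem (fun h' => lt_asymm hx h') _
        exact continuousAt_const.congr this.symm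
      · have : H =ᶠ[nhds (t₀ - s)] g := by
          filter_upwards [Ioi_mem_nhds hgt] with x hx
          exact indicator_of_mem hx _
        exact hgc.continuousAt.congr this.symm
    exact ContinuousAt.comp (f := fun t => t - s) hca (by fun_prop)

/-- Exponential weights make the convolution with `K` small. -/
theorem exists_volterra_exp_le (hK : ∀ T, IntegrableOn K (Ioc 0 T)) (hK0 : ∀ t, 0 < t → 0 ≤ K t)
    (M T : ℝ) (hM : 0 ≤ M) : ∃ μ : ℝ, 0 ≤ μ ∧ ∀ t ∈ Icc 0 T,
      M * volterra K (fun s => Real.exp (μ * s)) t ≤ Real.exp (μ * t) / 2 := by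
  -- Dividing the convolution by `e^{μt}` leaves `∫₀ᵗ K(s) e^{-μs} ds`, which is small for large
  -- `μ`, uniformly in `t ≤ T`.
  have hlim : Filter.Tendsto (fun n : ℕ => ∫ s in Ioc 0 T, K s * Real.exp (-(n * s)))
      Filter.atTop (nhds (∫ s in Ioc 0 T, (0 : ℝ))) := by
    refine tendsto_integral_of_dominated_convergence (fun s => ‖K s‖) (fun n => ?_)
      (hK T).norm (fun n => ?_) ?_
    · exact (hK T).aestronglyMeasurable.mul (by fun_prop)
    · filter_upwards [ae_restrict_mem measurableSet_Ioc] with s hs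
      rw [norm_mul, Real.norm_of_nonneg (Real.exp_pos _).le]
      refine mul_le_of_le_one_right (norm_nonneg _) (Real.exp_le_one_iff.2 ?_)
      have := hs.1.le
      simp only [Left.neg_nonpos_iff]
      positivity
    · filter_upwards [ae_restrict_mem measurableSet_Ioc] with s hs
      rw [← mul_zero (K s)]
      refine Filter.Tendsto.const_mul _ (Real.tendsto_exp_neg_atTop_nhds_zero.comp ?_)
      exact tendsto_natCast_atTop_atTop.atTop_mul_const hs.1
  have hlim' := hlim.const_mul M
  simp only [integral_zero, mul_zero] at hlim'
  obtain ⟨n, hn⟩ := (hlim'.eventually (ge_mem_nhds (show (0 : ℝ) < 1 / 2 by norm_num))).exists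
  refine ⟨n, by positivity, fun t ht => ?_⟩
  have h1 : volterra K (fun s => Real.exp (n * s)) t
      = Real.exp (n * t) * ∫ s in Ioc 0 t, K s * Real.exp (-(n * s)) := by
    rw [volterra_eq_integral_comp_sub, intervalIntegral.integral_of_le ht.1, ← integral_const_mul]
    congr 1; ext s
    rw [smul_eq_mul, mul_sub, sub_eq_add_neg, Real.exp_add]; ring
  have h2 : ∫ s in Ioc 0 t, K s * Real.exp (-(n * s))
      ≤ ∫ s in Ioc 0 T, K s * Real.exp (-(n * s)) := by
    refine setIntegral_mono_set ?_ ?_ (Ioc_subset_Ioc_right ht.2).eventuallyLE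
    · refine Integrable.mono (hK T) ((hK T).aestronglyMeasurable.mul
        (by fun_prop : Continuous fun s : ℝ => Real.exp (-(n * s))).aestronglyMeasurable) ?_
      filter_upwards [ae_restrict_mem measurableSet_Ioc] with s hs
      rw [norm_mul, Real.norm_of_nonneg (Real.exp_pos _).le]
      refine mul_le_of_le_one_right (norm_nonneg _) (Real.exp_le_one_iff.2 ?_)
      have := hs.1.le
      simp only [Left.neg_nonpos_iff]
      positivity
    · filter_upwards [ae_restrict_mem measurableSet_Ioc] with s hs
      exact mul_nonneg (hK0 s hs.1) (Real.exp_pos _).le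
  rw [h1]
  have h3 : M * ∫ s in Ioc 0 t, K s * Real.exp (-(n * s)) ≤ 1 / 2 :=
    (mul_le_mul_of_nonneg_left h2 hM).trans hn
  have := mul_le_mul_of_nonneg_left h3 (Real.exp_pos (n * t)).le
  linarith

/-- A Gronwall inequality for Volterra convolutions. -/
theorem volterra_gronwall (hK : ∀ T, IntegrableOn K (Ioc 0 T)) (hK0 : ∀ t, 0 < t → 0 ≤ K t)
    {M T μ C : ℝ} (hM : 0 ≤ M) (hμ : ∀ t ∈ Icc 0 T,
      M * volterra K (fun s => Real.exp (μ * s)) t ≤ Real.exp (μ * t) / 2)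
    (hμ0 : 0 ≤ μ) (hC : 0 ≤ C) {d : ℝ → ℝ} (hd : ContinuousOn d (Icc 0 T))
    (hd0 : ∀ t ∈ Icc 0 T, 0 ≤ d t)
    (hle : ∀ t ∈ Icc 0 T, d t ≤ C + M * volterra K d t) :
    ∀ t ∈ Icc 0 T, d t ≤ 2 * C * Real.exp (μ * t) := by
  intro t ht
  have hT : 0 ≤ T := ht.1.trans ht.2
  -- For the maximum `m` of `e^{-μs} d(s)`, the choice of `μ` gives `m ≤ C + m/2`.
  obtain ⟨r, hr, hmax⟩ := isCompact_Icc.exists_isMaxOn (nonempty_Icc.2 hT)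
    (f := fun s => Real.exp (-(μ * s)) * d s) (by fun_prop)
  set m := Real.exp (-(μ * r)) * d r with hm
  have hdm : ∀ s ∈ Icc 0 T, d s ≤ m * Real.exp (μ * s) := by
    intro s hs
    have h1 : Real.exp (-(μ * s)) * d s ≤ m := hmax hs
    have h2 := mul_le_mul_of_nonneg_right h1 (Real.exp_pos (μ * s)).le
    have h3 : Real.exp (-(μ * s)) * Real.exp (μ * s) = 1 := by rw [← Real.exp_add]; simp
    linear_combination h2 - d s * h3
  have hm0 : 0 ≤ m := mul_nonneg (Real.exp_pos _).le (hd0 r hr)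
  have hv : volterra K d r ≤ m * volterra K (fun s => Real.exp (μ * s)) r := by
    rw [← volterra_const_mul]
    exact volterra_mono hK hK0 hr.1 (hd.mono (Icc_subset_Icc_right hr.2)) (by fun_prop)
      fun s hs => hdm s ⟨hs.1, hs.2.trans hr.2⟩
  have h1 : d r ≤ C + m * (Real.exp (μ * r) / 2) := by
    have h2 := mul_le_mul_of_nonneg_left hv hM
    have h3 := mul_le_mul_of_nonneg_left (hμ r hr) hm0
    linarith [hle r hr]
  have h4 : m ≤ 2 * C := by
    have h5 : Real.exp (-(μ * r)) * Real.exp (μ * r) = 1 := by rw [← Real.exp_add]; simp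
    have h6 : Real.exp (-(μ * r)) ≤ 1 := Real.exp_le_one_iff.2 (by nlinarith [hr.1])
    have h7 := mul_le_mul_of_nonneg_left h1 (Real.exp_pos (-(μ * r))).le
    have h8 : Real.exp (-(μ * r)) * (C + m * (Real.exp (μ * r) / 2))
        = Real.exp (-(μ * r)) * C + m / 2 := by linear_combination (m / 2) * h5
    have h9 := mul_le_mul_of_nonneg_right h6 hC
    linarith
  exact (hdm t ht).trans (mul_le_mul_of_nonneg_right h4 (Real.exp_pos _).le)

/-- Volterra equations with a globally Lipschitz nonlinearity are solvable. -/
theorem exists_volterra_solution (hK : ∀ T, IntegrableOn K (Ioc 0 T))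
    (hK0 : ∀ t, 0 < t → 0 ≤ K t) {T : ℝ} (hT : 0 ≤ T) [CompleteSpace E] {G : E → E} {M : ℝ}
    (hM : 0 ≤ M) (hG : ∀ x y, ‖G x - G y‖ ≤ M * ‖x - y‖) :
    ∃ ψ : ℝ → E, Continuous ψ ∧ ∀ t ∈ Icc 0 T, ψ t = volterra K (fun s => G (ψ s)) t := by
  obtain ⟨μ, hμ0, hμ⟩ := exists_volterra_exp_le hK hK0 M T hM
  have hGc : Continuous G :=
    (LipschitzWith.of_dist_le_mul (K := ⟨M, hM⟩) fun x y => by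
      rw [dist_eq_norm, dist_eq_norm]; exact hG x y).continuous
  -- The unknown is `χ(t) = e^{-μt} ψ(t)`: the weight makes the integral operator a contraction on
  -- all of `[0, T]` at once.
  let X (χ : C(Icc 0 T, E)) (s : ℝ) : E := Real.exp (μ * s) • χ (projIcc 0 T hT s)
  have hX (χ : C(Icc 0 T, E)) : Continuous (X χ) := by
    have : Continuous fun s => χ (projIcc 0 T hT s) := χ.continuous.comp continuous_projIcc
    fun_prop
  have hGX (χ : C(Icc 0 T, E)) (A : Set ℝ) : ContinuousOn (fun s => G (X χ s)) A :=
    (hGc.comp (hX χ)).continuousOn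
  let Φ (χ : C(Icc 0 T, E)) : C(Icc 0 T, E) :=
    ⟨fun t => Real.exp (-(μ * t)) • volterra K (fun s => G (X χ s)) t, by
      have h1 : Continuous fun t : Icc 0 T => volterra K (fun s => G (X χ s)) (t : ℝ) :=
        continuousOn_iff_continuous_domRestrict.1 (continuousOn_volterra hK hT (hGX χ _))
      fun_prop⟩
  have hΦ : ContractingWith (1 / 2) Φ := by
    refine ⟨by rw [← NNReal.coe_lt_coe]; norm_num, LipschitzWith.of_dist_le_mul fun χ χ' => ?_⟩
    rw [ContinuousMap.dist_le (by positivity)]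
    rintro ⟨t, ht⟩
    have h1 : ‖volterra K (fun s => G (X χ s) - G (X χ' s)) t‖
        ≤ volterra K (fun s => M * dist χ χ' * Real.exp (μ * s)) t := by
      refine norm_volterra_le hK hK0 ht.1 ((hGX χ _).sub (hGX χ' _)) (by fun_prop) fun s hs => ?_
      refine (hG _ _).trans ?_
      rw [mul_assoc]
      refine mul_le_mul_of_nonneg_left ?_ hM
      rw [← smul_sub, norm_smul, Real.norm_of_nonneg (Real.exp_pos _).le, mul_comm,
        ← dist_eq_norm]
      exact mul_le_mul_of_nonneg_right (ContinuousMap.dist_apply_le_dist _) (Real.exp_pos _).le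
    rw [volterra_const_mul, volterra_sub hK ht.1 (hGX χ _) (hGX χ' _)] at h1
    have h2 : dist (Φ χ ⟨t, ht⟩) (Φ χ' ⟨t, ht⟩) = Real.exp (-(μ * t)) *
        ‖volterra K (fun s => G (X χ s)) t - volterra K (fun s => G (X χ' s)) t‖ := by
      change dist (Real.exp (-(μ * t)) • volterra K (fun s => G (X χ s)) t)
        (Real.exp (-(μ * t)) • volterra K (fun s => G (X χ' s)) t) = _
      rw [dist_eq_norm, ← smul_sub, norm_smul, Real.norm_of_nonneg (Real.exp_pos _).le]
    rw [h2]
    have h3 := mul_le_mul_of_nonneg_left (hμ t ht) (dist_nonneg (x := χ) (y := χ'))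
    have h4 : Real.exp (-(μ * t)) * Real.exp (μ * t) = 1 := by rw [← Real.exp_add]; simp
    calc _ ≤ Real.exp (-(μ * t)) * (dist χ χ' * (Real.exp (μ * t) / 2)) := by
          refine mul_le_mul_of_nonneg_left (h1.trans (le_trans (le_of_eq ?_) h3))
            (Real.exp_pos _).le
          ring
      _ = ((1 / 2 : NNReal) : ℝ) * dist χ χ' := by
          push_cast
          linear_combination (dist χ χ' / 2) * h4
  have : Nonempty C(Icc 0 T, E) := ⟨0⟩
  set χ := ContractingWith.fixedPoint Φ hΦ with hχ
  have hfix : Φ χ = χ := hΦ.fixedPoint_isFixedPt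
  refine ⟨X χ, hX χ, fun t ht => ?_⟩
  have h1 : Real.exp (-(μ * t)) • volterra K (fun s => G (X χ s)) t = χ ⟨t, ht⟩ :=
    DFunLike.congr_fun hfix ⟨t, ht⟩
  have h2 : X χ t = Real.exp (μ * t) • χ ⟨t, ht⟩ := by simp [X, projIcc_of_mem hT ht]
  rw [h2, ← h1, smul_smul, ← Real.exp_add]
  simp

end Volterra

/-! ### The resolvent of the first kind and its translates. -/

section Resolvent

variable {K : ℝ → ℝ} {L : Measure ℝ}

theorem measure_Iic_lt_top (hL0 : L (Iio 0) = 0) (hLfin : ∀ T : ℝ, L (Icc 0 T) < ⊤) (T : ℝ) :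
    L (Iic T) < ⊤ := by
  have : Iic T ⊆ Iio 0 ∪ Icc 0 T := fun x hx =>
    (lt_or_ge x 0).elim (fun h => Or.inl h) fun h => Or.inr ⟨h, hx⟩
  refine (measure_mono this).trans_lt ((measure_union_le _ _).trans_lt ?_)
  rw [hL0, zero_add]
  exact hLfin T

theorem isLocallyFiniteMeasure_of_Icc (hL0 : L (Iio 0) = 0)
    (hLfin : ∀ T : ℝ, L (Icc 0 T) < ⊤) : IsLocallyFiniteMeasure L :=
  ⟨fun x => ⟨Iic (x + 1), Iic_mem_nhds (lt_add_one x), measure_Iic_lt_top hL0 hLfin _⟩⟩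

/-- A measure is dominated by another one as soon as this holds on compact intervals. -/
theorem measure_le_of_Icc_le {N L : Measure ℝ} (hL : ∀ T : ℝ, L (Iic T) < ⊤)
    (hle : ∀ a b : ℝ, N (Icc a b) ≤ L (Icc a b)) : N ≤ L := by
  have hIoc : ∀ a b : ℝ, N (Ioc a b) ≤ L (Ioc a b) := by
    intro a b
    have hU : Ioc a b = ⋃ n : ℕ, Icc (a + 1 / ((n : ℝ) + 1)) b := by
      ext x
      simp only [mem_Ioc, mem_iUnion, mem_Icc]
      constructor
      · rintro ⟨h1, h2⟩
        obtain ⟨n, hn⟩ := exists_nat_one_div_lt (sub_pos.2 h1)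
        exact ⟨n, by linarith, h2⟩
      · rintro ⟨n, h1, h2⟩
        have : (0 : ℝ) < 1 / ((n : ℝ) + 1) := by positivity
        exact ⟨by linarith, h2⟩
    have hmono : Monotone fun n : ℕ => Icc (a + 1 / ((n : ℝ) + 1)) b := by
      intro m n hmn
      refine Icc_subset_Icc_left ?_
      have := Nat.one_div_le_one_div (α := ℝ) hmn
      linarith
    rw [hU, hmono.measure_iUnion, hmono.measure_iUnion]
    exact iSup_mono fun n => hle _ _
  have hIic : ∀ b : ℝ, N (Iic b) ≤ L (Iic b) := by
    intro b
    have hU : Iic b = ⋃ n : ℕ, Ioc (-(n : ℝ)) b := by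
      ext x
      simp only [mem_Iic, mem_iUnion, mem_Ioc]
      refine ⟨fun h => ?_, fun ⟨n, hn⟩ => hn.2⟩
      obtain ⟨n, hn⟩ := exists_nat_gt (-x)
      exact ⟨n, by linarith, h⟩
    have hmono : Monotone fun n : ℕ => Ioc (-(n : ℝ)) b := by
      intro m n hmn
      exact Ioc_subset_Ioc_left (neg_le_neg (Nat.cast_le.2 hmn))
    rw [hU, hmono.measure_iUnion, hmono.measure_iUnion]
    exact iSup_mono fun n => hIoc _ _
  have hN : ∀ T : ℝ, N (Iic T) < ⊤ := fun T => (hIic T).trans_lt (hL T)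
  have hsplit : ∀ (μ : Measure ℝ), (∀ T : ℝ, μ (Iic T) < ⊤) → ∀ a b : ℝ, a ≤ b →
      μ.real (Iic b) - μ.real (Iic a) = μ.real (Ioc a b) := by
    intro μ hμ a b hab
    have : Ioc a b = Iic b \ Iic a := by ext x; simp [and_comm]
    rw [this, measureReal_sdiff (Iic_subset_Iic.2 hab) measurableSet_Iic (hμ b).ne]
  have hright : ∀ (μ : Measure ℝ), (∀ T : ℝ, μ (Iic T) < ⊤) → ∀ x : ℝ,
      ContinuousWithinAt (fun t => μ.real (Iic t)) (Ici x) x := by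
    intro μ hμ x
    rw [← continuousWithinAt_Ioi_iff_Ici]
    have h1 := tendsto_measure_biInter_gt (μ := μ) (s := fun t : ℝ => Iic t) (a := x)
      (fun r _ => measurableSet_Iic.nullMeasurableSet) (fun i j _ hij => Iic_subset_Iic.2 hij)
      ⟨x + 1, lt_add_one x, (hμ _).ne⟩
    have h2 : ⋂ r > x, Iic r = Iic x := by
      ext y
      simp only [mem_iInter, mem_Iic]
      exact ⟨fun h => le_of_forall_gt_imp_ge_of_dense h, fun h r hr => h.trans hr.le⟩
    rw [h2] at h1
    exact (ENNReal.tendsto_toReal (hμ x).ne).comp h1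
  -- The difference of the distribution functions is itself a distribution function, so `L` is `N`
  -- plus a nonnegative measure.
  let G : StieltjesFunction ℝ :=
    { toFun := fun t => L.real (Iic t) - N.real (Iic t)
      mono' := by
        intro a b hab
        have h1 := hsplit L hL a b hab
        have h2 := hsplit N hN a b hab
        have h3 : N.real (Ioc a b) ≤ L.real (Ioc a b) :=
          ENNReal.toReal_mono ((measure_mono Ioc_subset_Iic_self).trans_lt (hL b)).ne (hIoc a b)
        simp only
        linarith
      right_continuous' := fun x => (hright L hL x).sub (hright N hN x) }
  have hEq : L = N + G.measure := by
    refine Measure.ext_of_Ioc' _ _ (fun a b _ =>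
      ((measure_mono Ioc_subset_Iic_self).trans_lt (hL b)).ne) fun a b hab => ?_
    have hNb : N (Ioc a b) ≠ ⊤ := ((measure_mono Ioc_subset_Iic_self).trans_lt (hN b)).ne
    have hLb : L (Ioc a b) ≠ ⊤ := ((measure_mono Ioc_subset_Iic_self).trans_lt (hL b)).ne
    have hG : G b - G a = L.real (Ioc a b) - N.real (Ioc a b) := by
      have h1 := hsplit L hL a b hab.le
      have h2 := hsplit N hN a b hab.le
      change (L.real (Iic b) - N.real (Iic b)) - (L.real (Iic a) - N.real (Iic a)) = _
      linarith
    rw [Measure.add_apply, G.measure_Ioc, hG, measureReal_def, measureReal_def,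
      ENNReal.ofReal_sub _ ENNReal.toReal_nonneg, ENNReal.ofReal_toReal hLb,
      ENNReal.ofReal_toReal hNb, add_tsub_cancel_of_le (hIoc a b)]
  rw [hEq]
  exact Measure.le_add_right le_rfl

/-- A nonincreasing measure on the half-line dominates its translates. -/
theorem restrict_map_sub_le (hL0 : L (Iio 0) = 0) (hLfin : ∀ T : ℝ, L (Icc 0 T) < ⊤)
    (hLanti : ∀ t : ℝ, 0 ≤ t → AntitoneOn (fun s : ℝ => L (Icc s (s + t))) (Ici 0))
    {δ : ℝ} (hδ : 0 ≤ δ) :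
    (L.map (MeasurableEquiv.subRight δ)).restrict (Ici 0) ≤ L := by
  refine measure_le_of_Icc_le (measure_Iic_lt_top hL0 hLfin) fun a b => ?_
  rw [Measure.restrict_apply measurableSet_Icc, MeasurableEquiv.map_apply]
  have hset : (MeasurableEquiv.subRight δ) ⁻¹' (Icc a b ∩ Ici 0)
      = Icc (max a 0 + δ) (b + δ) := by
    ext x
    simp only [MeasurableEquiv.subRight, mem_preimage, mem_inter_iff, mem_Icc, mem_Ici]
    change (a ≤ x - δ ∧ x - δ ≤ b) ∧ 0 ≤ x - δ ↔ _
    rw [← le_sub_iff_add_le, max_le_iff, sub_le_iff_le_add]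
    tauto
  rw [hset]
  rcases le_or_gt (max a 0) b with h | h
  · have h0 : (0 : ℝ) ≤ max a 0 := le_max_right _ _
    have := hLanti (b - max a 0) (sub_nonneg.2 h) (mem_Ici.2 h0)
      (mem_Ici.2 (add_nonneg h0 hδ)) (le_add_of_nonneg_right hδ)
    simp only [add_sub_cancel] at this
    rw [show max a 0 + δ + (b - max a 0) = b + δ by ring] at this
    exact this.trans (measure_mono (Icc_subset_Icc_left (le_max_left _ _)))
  · rw [Icc_eq_empty (by linarith), measure_empty]
    exact zero_le

theorem ae_measure_singleton_eq_zero (L : Measure ℝ) [SFinite L] :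
    ∀ᵐ t : ℝ, L {t} = 0 := by
  have hc : Set.Countable {t : ℝ | 0 < L {t}} :=
    Measure.countable_meas_pos_of_disjoint_iUnion (fun t => measurableSet_singleton t)
      fun s t hst => by simpa using hst
  have := hc.ae_notMem (volume : Measure ℝ)
  filter_upwards [this] with t ht
  exact nonpos_iff_eq_zero.1 (not_lt.1 ht)

/-- Convolving `K ∗ P` with the resolvent of the first kind gives the primitive of `P`. -/
theorem integral_volterra_resolvent
    (hK0 : ∀ t, 0 < t → 0 ≤ K t) (hKc : ContinuousOn K (Ioi 0))
    (hL : IsNonnegResolventFirstKind K L) {P : ℝ → ℝ} (hP : Continuous P) {t : ℝ} (ht : 0 ≤ t) :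
    ∫ s in Icc 0 t, volterra K P (t - s) ∂L = ∫ r in (0 : ℝ)..t, P r := by
  have : IsLocallyFiniteMeasure L :=
    isLocallyFiniteMeasure_of_Icc hL.support_nonneg hL.finite_on_compacts
  have : IsFiniteMeasure (L.restrict (Icc 0 t)) :=
    ⟨by rw [Measure.restrict_apply_univ]; exact hL.finite_on_compacts t⟩
  -- Extending `K` by zero puts both iterated integrals on fixed sets and discards the arbitrary
  -- value `K 0`.
  set k : ℝ → ℝ := (Ioi 0).indicator K with hk
  have hkm : Measurable k := by
    classical
    rw [hk, ← piecewise_eq_indicator]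
    exact hKc.measurable_piecewise continuousOn_const measurableSet_Ioi
  have hk0 : ∀ x, 0 ≤ k x := fun x => indicator_nonneg (fun y hy => hK0 y hy) x
  have hinner : ∀ s ∈ Icc 0 t,
      ∫ r in Ioc 0 t, k (t - s - r) * P r = volterra K P (t - s) := by
    intro s hs
    rw [volterra, intervalIntegral.integral_of_le (sub_nonneg.2 hs.2),
      integral_Ioc_eq_integral_Ioo (x := 0) (y := t - s),
      setIntegral_eq_of_subset_of_forall_sdiff_eq_zero (s := Ioo 0 (t - s)) measurableSet_Ioc
        (fun r hr => ⟨hr.1, hr.2.le.trans (sub_le_self _ hs.1)⟩)]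
    · refine setIntegral_congr_fun measurableSet_Ioo fun r hr => ?_
      simp [hk, indicator_of_mem (mem_Ioi.2 (sub_pos.2 hr.2))]
    · intro r hr
      have : t - s - r ∉ Ioi (0 : ℝ) := fun h' => hr.2 ⟨hr.1.1, sub_pos.1 h'⟩
      rw [hk, indicator_of_notMem this, zero_mul]
  -- The resolvent identity at `t - r`. It involves `K 0` at the endpoint `s = t - r`, which is
  -- harmless unless `L` has an atom there; only countably many `r` are lost.
  have hone : ∀ᵐ r ∂volume.restrict (Ioc 0 t),
      ∫ s in Icc 0 t, k (t - s - r) ∂L = 1 := by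
    have h1 : ∀ᵐ τ : ℝ, (0 < τ → ∫ s in Icc 0 τ, K (τ - s) ∂L = 1) ∧ L {τ} = 0 :=
      ((ae_restrict_iff' measurableSet_Ioi).1 hL.conv_eq_one).and (ae_measure_singleton_eq_zero L)
    have h2 := (volume.measurePreserving_sub_left t).quasiMeasurePreserving.ae h1
    rw [← restrict_Ioo_eq_restrict_Ioc]
    filter_upwards [ae_restrict_of_ae h2, ae_restrict_mem measurableSet_Ioo] with r hr hrm
    rw [← hr.1 (sub_pos.2 hrm.2)]
    have h3 : (Ico 0 (t - r) : Set ℝ) =ᵐ[L] Icc 0 (t - r) := Ico_ae_eq_Icc' hr.2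
    rw [← setIntegral_congr_set h3,
      setIntegral_eq_of_subset_of_forall_sdiff_eq_zero (s := Ico 0 (t - r)) measurableSet_Icc
        (fun s hs => ⟨hs.1, hs.2.le.trans (sub_le_self _ hrm.1.le)⟩)]
    · refine setIntegral_congr_fun measurableSet_Ico fun s hs => ?_
      have : t - s - r ∈ Ioi (0 : ℝ) := mem_Ioi.2 (by linarith [hs.2])
      simp only [hk, indicator_of_mem this]
      congr 1; ring
    · intro s hs
      have : t - s - r ∉ Ioi (0 : ℝ) :=
        fun h' => hs.2 ⟨hs.1.1, by linarith [mem_Ioi.1 h']⟩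
      rw [hk, indicator_of_notMem this]
  have hint : Integrable (Function.uncurry fun s r => k (t - s - r) * P r)
      ((L.restrict (Icc 0 t)).prod (volume.restrict (Ioc 0 t))) := by
    have hm : Measurable (Function.uncurry fun s r => k (t - s - r) * P r) := by
      have : Measurable fun p : ℝ × ℝ => t - p.1 - p.2 := by fun_prop
      exact (hkm.comp this).mul (hP.measurable.comp measurable_snd)
    rw [integrable_prod_iff' hm.aestronglyMeasurable]
    constructor
    · filter_upwards [hone] with r hr
      have : Integrable (fun s => k (t - s - r)) (L.restrict (Icc 0 t)) := by
        -- A non-integrable function would have integral `0` by convention, but the integral is `1`.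
        by_contra h
        rw [integral_undef h] at hr
        exact zero_ne_one hr
      exact this.mul_const (P r)
    · have hPi : Integrable (fun r => ‖P r‖) (volume.restrict (Ioc 0 t)) :=
        (hP.norm.continuousOn.integrableOn_Icc).mono_set Ioc_subset_Icc_self
      refine hPi.congr ?_
      filter_upwards [hone] with r hr
      simp only [Function.uncurry, norm_mul, Real.norm_of_nonneg (hk0 _)]
      rw [integral_mul_const, hr, one_mul]
  rw [← setIntegral_congr_fun measurableSet_Icc hinner, integral_integral_swap hint,
    intervalIntegral.integral_of_le ht]
  refine integral_congr_ae ?_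
  filter_upwards [hone] with r hr
  rw [integral_mul_const, hr, one_mul]

end Resolvent

/-! ### Extremum and comparison principles for `K ∗ h`. -/

section MaximumPrinciple

variable {K : ℝ → ℝ} {L : Measure ℝ}

/-- Away from the origin, convolution with a nonincreasing kernel keeps Lipschitz bounds. -/
theorem exists_volterra_lipschitz (hK : ∀ T, IntegrableOn K (Ioc 0 T))
    (hK0 : ∀ t, 0 < t → 0 ≤ K t) (hKa : AntitoneOn K (Ioi 0)) {P : ℝ → ℝ} (hP : Continuous P)
    {t C : ℝ} (ht : 0 < t) (hPL : ∀ x ∈ Icc 0 t, ∀ y ∈ Icc 0 t, |P x - P y| ≤ C * |x - y|) :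
    ∃ A, 0 ≤ A ∧ ∀ s ∈ Icc 0 (t / 2), volterra K P (t - s) - volterra K P t ≤ A * s := by
  obtain ⟨B, hB⟩ := isCompact_Icc.exists_bound_of_continuousOn (s := Icc 0 t) hP.continuousOn
  have hB0 : 0 ≤ B := (norm_nonneg _).trans (hB 0 ⟨le_rfl, ht.le⟩)
  have hC0 : 0 ≤ C := by
    have h1 := hPL t ⟨ht.le, le_rfl⟩ 0 ⟨le_rfl, ht.le⟩
    have h2 := (abs_nonneg _).trans h1
    rw [sub_zero, abs_of_pos ht] at h2
    exact nonneg_of_mul_nonneg_left h2 ht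
  have hI0 : ∀ s t : ℝ, 0 ≤ s → s ≤ t → 0 ≤ ∫ r in s..t, K r := fun s t hs hst => by
    rw [intervalIntegral.integral_of_le hst]
    exact setIntegral_nonneg measurableSet_Ioc fun x hx => hK0 x (hs.trans_lt hx.1)
  refine ⟨C * (∫ r in (0 : ℝ)..t, K r) + B * K (t / 2),
    add_nonneg (mul_nonneg hC0 (hI0 _ _ le_rfl ht.le))
      (mul_nonneg hB0 (hK0 _ (half_pos ht))), fun s hs => ?_⟩
  have hts : 0 ≤ t - s := by linarith [hs.2]
  have hi1 : IntervalIntegrable (fun r => K r * P (t - r)) volume 0 (t - s) :=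
    (intervalIntegrable_kernel hK hts).mul_continuousOn (by fun_prop)
  have hi1' : IntervalIntegrable (fun r => K r * P (t - s - r)) volume 0 (t - s) :=
    (intervalIntegrable_kernel hK hts).mul_continuousOn (by fun_prop)
  have hKi : IntervalIntegrable K volume (t - s) t :=
    (intervalIntegrable_kernel hK hts).symm.trans (intervalIntegrable_kernel hK ht.le)
  have hi2 : IntervalIntegrable (fun r => K r * P (t - r)) volume (t - s) t :=
    hKi.mul_continuousOn (by fun_prop)
  -- The first integral is controlled by the Lipschitz constant of `P`. The second covers a length
  -- `s` on which `r ≥ t/2`, so `K r ≤ K (t/2)` there despite a possible singularity at `0`.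
  have e1 : volterra K P (t - s) - volterra K P t
      = (∫ r in (0 : ℝ)..(t - s), (K r * P (t - s - r) - K r * P (t - r)))
        - ∫ r in (t - s)..t, K r * P (t - r) := by
    rw [volterra_eq_integral_comp_sub, volterra_eq_integral_comp_sub,
      intervalIntegral.integral_sub hi1' hi1]
    simp only [smul_eq_mul]
    rw [← intervalIntegral.integral_add_adjacent_intervals hi1 hi2]
    ring
  have b1 : (∫ r in (0 : ℝ)..(t - s), (K r * P (t - s - r) - K r * P (t - r)))
      ≤ ∫ r in (0 : ℝ)..(t - s), K r * (C * s) := by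
    refine intervalIntegral.integral_mono_on_of_le_Ioo hts (hi1'.sub hi1)
      ((intervalIntegrable_kernel hK hts).mul_const _) fun r hr => ?_
    rw [← mul_sub]
    refine mul_le_mul_of_nonneg_left ?_ (hK0 r hr.1)
    have h1 := hPL (t - s - r) ⟨by linarith [hr.2], by linarith [hr.1, hs.1]⟩ (t - r)
      ⟨by linarith [hr.2, hs.1], by linarith [hr.1]⟩
    rw [show t - s - r - (t - r) = -s by ring, abs_neg, abs_of_nonneg hs.1] at h1
    exact (le_abs_self _).trans h1
  have b2 : ∫ r in (0 : ℝ)..(t - s), K r * (C * s) ≤ C * (∫ r in (0 : ℝ)..t, K r) * s := by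
    rw [intervalIntegral.integral_mul_const,
      ← intervalIntegral.integral_add_adjacent_intervals (intervalIntegrable_kernel hK hts) hKi]
    have := mul_nonneg (hI0 (t - s) t hts (by linarith [hs.1])) (mul_nonneg hC0 hs.1)
    linarith
  have b3 : -(∫ r in (t - s)..t, K r * P (t - r)) ≤ ∫ r in (t - s)..t, K (t / 2) * B := by
    rw [← intervalIntegral.integral_neg]
    refine intervalIntegral.integral_mono_on (by linarith [hs.1]) hi2.neg
      intervalIntegrable_const fun r hr => ?_
    have hr0 : 0 < r := by linarith [hr.1, hs.2]
    have h1 : K r ≤ K (t / 2) := hKa (mem_Ioi.2 (half_pos ht)) (mem_Ioi.2 hr0)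
      (by linarith [hr.1, hs.2])
    have h2 := hB (t - r) ⟨by linarith [hr.2], by linarith⟩
    rw [← mul_neg]
    calc K r * -P (t - r) ≤ K r * B :=
          mul_le_mul_of_nonneg_left ((neg_le_abs _).trans h2) (hK0 r hr0)
      _ ≤ _ := mul_le_mul_of_nonneg_right h1 hB0
  rw [intervalIntegral.integral_const, smul_eq_mul] at b3
  rw [e1]
  nlinarith [b1, b2, b3]

/-- Extremum principle: at a nonpositive minimum of `K ∗ P` the function `P` is nonpositive. -/
theorem nonpos_of_volterra_isMin (hK : ∀ T, IntegrableOn K (Ioc 0 T))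
    (hK0 : ∀ t, 0 < t → 0 ≤ K t) (hKa : AntitoneOn K (Ioi 0)) (hKc : ContinuousOn K (Ioi 0))
    (hL : IsNonnegResolventFirstKind K L)
    (hLanti : ∀ t : ℝ, 0 ≤ t → AntitoneOn (fun s : ℝ => L (Icc s (s + t))) (Ici 0))
    {P : ℝ → ℝ} (hP : Continuous P)
    {t C : ℝ} (ht : 0 < t) (hPL : ∀ x ∈ Icc 0 t, ∀ y ∈ Icc 0 t, |P x - P y| ≤ C * |x - y|)
    (hmin : ∀ s ∈ Icc 0 t, volterra K P t ≤ volterra K P s) (hneg : volterra K P t ≤ 0) :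
    P t ≤ 0 := by
  by_contra! hPt
  have : IsLocallyFiniteMeasure L :=
    isLocallyFiniteMeasure_of_Icc hL.support_nonneg hL.finite_on_compacts
  obtain ⟨A, hA0, hA⟩ := exists_volterra_lipschitz hK hK0 hKa hP ht hPL
  set f := volterra K P with hf
  have hfc : ContinuousOn f (Icc 0 t) := continuousOn_volterra hK ht.le hP.continuousOn
  -- choice of the step
  have hsmall : ∀ᶠ δ in nhdsWithin (0 : ℝ) (Ioi 0), A * L.real (Ioo 0 δ) < P t / 2 := by
    have h1 := tendsto_measure_biInter_gt (μ := L) (s := fun δ : ℝ => Ioo 0 δ) (a := 0)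
      (fun r _ => measurableSet_Ioo.nullMeasurableSet) (fun i j _ hij => Ioo_subset_Ioo_right hij)
      ⟨1, one_pos, measure_Ioo_lt_top.ne⟩
    have h2 : ⋂ r > (0 : ℝ), Ioo 0 r = ∅ := by
      ext y
      simp only [mem_iInter, mem_Ioo, mem_empty_iff_false, iff_false]
      intro h
      exact lt_irrefl y (h y (h 1 one_pos).1).2
    rw [h2, measure_empty] at h1
    have h3 := ((ENNReal.tendsto_toReal ENNReal.zero_ne_top).comp h1).const_mul A
    simp only [ENNReal.toReal_zero, mul_zero] at h3
    exact h3.eventually (gt_mem_nhds (half_pos hPt))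
  have hnear : ∀ᶠ δ in nhdsWithin (0 : ℝ) (Ioi 0), ∀ x, |x - t| ≤ δ → P t / 2 ≤ P x := by
    obtain ⟨ε, hε, h⟩ := Metric.eventually_nhds_iff.1
      (hP.continuousAt.eventually (le_mem_nhds (half_lt_self hPt)))
    filter_upwards [Ioo_mem_nhdsGT hε] with δ hδ x hx
    exact h (by rw [Real.dist_eq]; exact hx.trans_lt hδ.2)
  obtain ⟨δ, ⟨hδs, hδn⟩, hδ0, hδt⟩ :=
    ((hsmall.and hnear).and (Ioo_mem_nhdsGT (half_pos ht))).exists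
  have htδ : 0 ≤ t - δ := by linarith
  -- Subtracting the minimum gives `p ≥ 0` and `p t = 0`; the constant `f t ≤ 0` then multiplies an
  -- increment of mass and contributes with the right sign.
  set p : ℝ → ℝ := fun s => f s - f t with hp
  have hp0 : ∀ s ∈ Icc 0 t, 0 ≤ p s := fun s hs => sub_nonneg.2 (hmin s hs)
  have hpc : ContinuousOn p (Icc 0 t) := hfc.sub continuousOn_const
  have hpi : ∀ r ∈ Icc 0 t, IntegrableOn (fun s => p (r - s)) (Icc 0 r) L := fun r hr =>
    (hpc.comp (by fun_prop) fun s hs =>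
      ⟨by linarith [hs.2], by linarith [hs.1, hr.2]⟩).integrableOn_Icc
  have hconst : ∀ r ∈ Icc 0 t, ∫ s in Icc 0 r, f (r - s) ∂L
      = (∫ s in Icc 0 r, p (r - s) ∂L) + f t * L.real (Icc 0 r) := by
    intro r hr
    have : ∀ s, f (r - s) = p (r - s) + f t := fun s => by simp [hp]
    simp only [this]
    rw [integral_add (hpi r hr) (integrableOn_const (measure_Icc_lt_top.ne)), setIntegral_const,
      smul_eq_mul, mul_comm]
  have e1 := integral_volterra_resolvent hK0 hKc hL hP ht.le
  have e2 := integral_volterra_resolvent hK0 hKc hL hP htδ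
  rw [← hf, hconst t ⟨ht.le, le_rfl⟩] at e1
  rw [← hf, hconst (t - δ) ⟨htδ, by linarith⟩] at e2
  have hmass : L.real (Icc 0 (t - δ)) ≤ L.real (Icc 0 t) :=
    measureReal_mono (Icc_subset_Icc_right (by linarith)) measure_Icc_lt_top.ne
  have hdiff : δ * (P t / 2) ≤ (∫ r in (0 : ℝ)..t, P r) - ∫ r in (0 : ℝ)..(t - δ), P r := by
    rw [intervalIntegral.integral_interval_sub_left (hP.intervalIntegrable _ _)
      (hP.intervalIntegrable _ _)]
    have : ∫ r in (t - δ)..t, P t / 2 ≤ ∫ r in (t - δ)..t, P r :=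
      intervalIntegral.integral_mono_on (by linarith) intervalIntegrable_const
        (hP.intervalIntegrable _ _) fun x hx =>
          hδn x (abs_le.2 ⟨by linarith [hx.1], by linarith [hx.2]⟩)
    rw [intervalIntegral.integral_const, smul_eq_mul] at this
    linarith
  have hsplit : ∫ s in Icc 0 t, p (t - s) ∂L
      = (∫ s in Ico 0 δ, p (t - s) ∂L) + ∫ s in Icc δ t, p (t - s) ∂L := by
    have hU : Icc 0 t = Ico 0 δ ∪ Icc δ t := (Ico_union_Icc_eq_Icc hδ0.le (by linarith)).symm
    have hi := hpi t ⟨ht.le, le_rfl⟩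
    rw [hU] at hi ⊢
    exact setIntegral_union
      (disjoint_left.2 fun x hx hx' => not_lt.2 hx'.1 hx.2) measurableSet_Icc
      hi.left_of_union hi.right_of_union
  -- A possible atom of `L` at `0` is killed by `p t = 0`. Only the mass of the open interval
  -- remains, which vanishes with `δ`.
  have hfirst : ∫ s in Ico 0 δ, p (t - s) ∂L ≤ δ * (A * L.real (Ioo 0 δ)) := by
    have h1 : ∫ s in Ico 0 δ, p (t - s) ∂L
        ≤ ∫ s in Ico 0 δ, (Ioo 0 δ).indicator (fun _ => A * δ) s ∂L := by
      refine setIntegral_mono_on ?_ ?_ measurableSet_Ico fun s hs => ?_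
      · exact (hpi t ⟨ht.le, le_rfl⟩).mono_set fun s hs => ⟨hs.1, by linarith [hs.2]⟩
      · exact (integrableOn_const measure_Ico_lt_top.ne).indicator measurableSet_Ioo
      · rcases hs.1.eq_or_lt with h | h
        · subst h
          simp [hp]
        · rw [indicator_of_mem (show s ∈ Ioo 0 δ from ⟨h, hs.2⟩)]
          exact (hA s ⟨hs.1, by linarith [hs.2]⟩).trans
            (mul_le_mul_of_nonneg_left hs.2.le hA0)
    rw [setIntegral_indicator measurableSet_Ioo, setIntegral_const,
      inter_eq_self_of_subset_right Ioo_subset_Ico_self, smul_eq_mul] at h1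
    linarith
  -- This is where the monotonicity of `L` enters: translating it to the left by `δ` does not
  -- increase it on the half-line, and `p ≥ 0`.
  have hshift : ∫ s in Icc δ t, p (t - s) ∂L ≤ ∫ s in Icc 0 (t - δ), p (t - δ - s) ∂L := by
    set e := MeasurableEquiv.subRight δ with he
    have heq : ∀ x, e x = x - δ := fun x => rfl
    have h1 : ∫ s in Icc δ t, p (t - s) ∂L
        = ∫ s in Icc 0 (t - δ), p (t - δ - s) ∂(L.map e) := by
      rw [setIntegral_map_equiv]
      have : e ⁻¹' Icc 0 (t - δ) = Icc δ t := by
        ext x; simp [heq]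
      rw [this]
      refine integral_congr_ae (Filter.Eventually.of_forall fun s => ?_)
      simp only [heq]
      congr 1; ring
    have h2 : (L.map e).restrict (Icc 0 (t - δ)) ≤ L.restrict (Icc 0 (t - δ)) := by
      have h3 := Measure.restrict_mono (s := Icc 0 (t - δ)) Subset.rfl
        (restrict_map_sub_le hL.support_nonneg hL.finite_on_compacts hLanti hδ0.le)
      rwa [Measure.restrict_restrict measurableSet_Icc,
        inter_eq_self_of_subset_left Icc_subset_Ici_self] at h3
    rw [h1]
    refine integral_mono_measure h2 ?_ (hpi (t - δ) ⟨htδ, by linarith⟩)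
    filter_upwards [ae_restrict_mem measurableSet_Icc] with s hs
    exact hp0 _ ⟨by linarith [hs.2], by linarith [hs.1]⟩
  have hfin := mul_le_mul_of_nonpos_left hmass hneg
  have := mul_lt_mul_of_pos_left hδs hδ0
  linarith

/-- The standing assumptions on the kernel, in the form in which they are used. -/
structure VolterraKernel (K : ℝ → ℝ) : Prop where
  integrableOn : ∀ T, IntegrableOn K (Ioc 0 T)
  nonneg : ∀ t, 0 < t → 0 ≤ K t
  antitoneOn : AntitoneOn K (Ioi 0)
  continuousOn : ContinuousOn K (Ioi 0)
  resolvent : ∃ L : Measure ℝ, IsNonnegResolventFirstKind K L ∧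
    ∀ t : ℝ, 0 ≤ t → AntitoneOn (fun s : ℝ => L (Icc s (s + t))) (Ici 0)

theorem KernelHypothesis.volterraKernel (hK : KernelHypothesis K) : VolterraKernel K where
  integrableOn T := by
    have : IntegrableOn K (Icc 0 T) := (hK.memL2_loc T).integrable (by norm_num)
    exact this.mono_set Ioc_subset_Icc_self
  nonneg := hK.nonneg
  antitoneOn := hK.nonincreasing
  continuousOn := hK.contDiff.continuousOn
  resolvent := hK.resolvent

/-- Weak minimum principle, strict form. -/
theorem VolterraKernel.neg_le_volterra_of_pos (hK : VolterraKernel K) {h : ℝ → ℝ} {T c : ℝ}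
    (hc : 0 ≤ c) (hh : ContinuousOn h (Icc 0 T))
    (hpos : ∀ t ∈ Icc 0 T, volterra K h t ≤ -c → 0 < h t) :
    ∀ t ∈ Icc 0 T, -c ≤ volterra K h t := by
  intro t₂ ht₂
  have hT : 0 ≤ T := ht₂.1.trans ht₂.2
  by_contra! hlt
  set f := volterra K h with hf
  have hfc : ContinuousOn f (Icc 0 T) := continuousOn_volterra hK.integrableOn hT hh
  -- uniform positivity near the bad set
  obtain ⟨θ, hθ, hθh⟩ : ∃ θ > 0, ∀ t ∈ Icc 0 T, f t ≤ -c + θ → θ ≤ h t := by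
    have hm : ContinuousOn (fun t => max (f t + c) (h t)) (Icc 0 T) :=
      (hfc.add continuousOn_const).sup hh
    obtain ⟨r, hr, hrmin⟩ := isCompact_Icc.exists_isMinOn (nonempty_Icc.2 hT) hm
    have hr0 : 0 < max (f r + c) (h r) := by
      rcases le_or_gt (f r) (-c) with h1 | h1
      · exact lt_max_of_lt_right (hpos r hr h1)
      · exact lt_max_of_lt_left (by linarith)
    refine ⟨max (f r + c) (h r) / 2, half_pos hr0, fun t ht h1 => ?_⟩
    have h2 : max (f r + c) (h r) ≤ max (f t + c) (h t) := hrmin ht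
    rcases le_max_iff.1 h2 with h3 | h3
    · linarith
    · linarith
  set I := volterra K (fun _ => (1 : ℝ)) T with hI
  have hI0 : 0 ≤ I := volterra_nonneg hK.nonneg hT fun _ _ => zero_le_one
  -- For a polynomial `P` within `ε` of `h`, `K ∗ P` is within `εI` of `f`. The three conditions
  -- keep `P` positive where `h ≥ θ`, put the minimum point of `K ∗ P` where `f ≤ -c + θ`, and keep
  -- `K ∗ P` below `-c` at `t₂`.
  obtain ⟨ε, hε0, hε1, hε2, hε3⟩ : ∃ ε > 0, ε < θ ∧ ε * I < θ ∧ ε * I < -c - f t₂ := by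
    have hm : 0 < min θ (-c - f t₂) := lt_min hθ (by linarith)
    refine ⟨min θ (-c - f t₂) / (2 * (I + 1)), by positivity, ?_, ?_, ?_⟩
    · rw [div_lt_iff₀ (by positivity)]
      nlinarith [min_le_left θ (-c - f t₂)]
    · rw [div_mul_eq_mul_div, div_lt_iff₀ (by positivity)]
      nlinarith [min_le_left θ (-c - f t₂)]
    · rw [div_mul_eq_mul_div, div_lt_iff₀ (by positivity)]
      nlinarith [min_le_right θ (-c - f t₂)]
  obtain ⟨P, hP⟩ := exists_polynomial_near_of_continuousOn 0 T h hh ε hε0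
  have hPc : Continuous fun x => P.eval x := P.continuous
  set g := volterra K (fun x => P.eval x) with hg
  have hgf : ∀ t ∈ Icc 0 T, |g t - f t| ≤ ε * I := by
    intro t ht
    have hh' : ContinuousOn h (Icc 0 t) := hh.mono (Icc_subset_Icc_right ht.2)
    have h1 := norm_volterra_le hK.integrableOn hK.nonneg ht.1
      (h := fun s => P.eval s - h s) (g := fun _ => ε * 1) (hPc.continuousOn.sub hh')
      continuousOn_const fun s hs => by
        rw [mul_one]; exact (hP s ⟨hs.1, hs.2.trans ht.2⟩).le
    rw [volterra_sub hK.integrableOn ht.1 hPc.continuousOn hh', volterra_const_mul] at h1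
    exact h1.trans (mul_le_mul_of_nonneg_left
      (volterra_one_mono hK.integrableOn hK.nonneg ht.1 ht.2) hε0.le)
  have hgc : ContinuousOn g (Icc 0 t₂) :=
    continuousOn_volterra hK.integrableOn ht₂.1 hPc.continuousOn
  obtain ⟨t₁, ht₁, hmin⟩ := isCompact_Icc.exists_isMinOn (nonempty_Icc.2 ht₂.1) hgc
  have ht₁T : t₁ ∈ Icc 0 T := ⟨ht₁.1, ht₁.2.trans ht₂.2⟩
  have hgt₂ : g t₂ < -c := by linarith [(abs_le.1 (hgf t₂ ht₂)).2]
  have hgt₁ : g t₁ ≤ g t₂ := hmin ⟨ht₂.1, le_rfl⟩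
  have hpos₁ : 0 < t₁ := by
    rcases ht₁.1.eq_or_lt with h0 | h0
    · rw [← h0, hg, volterra_zero] at hgt₁
      linarith
    · exact h0
  have hft₁ : f t₁ ≤ -c + θ := by linarith [(abs_le.1 (hgf t₁ ht₁T)).1]
  have hPt₁ : 0 < P.eval t₁ := by
    have h1 := hθh t₁ ht₁T hft₁
    have h2 := (abs_lt.1 (hP t₁ ht₁T)).1
    linarith
  obtain ⟨C, hC⟩ : ∃ C, ∀ x ∈ Icc 0 t₁, ∀ y ∈ Icc 0 t₁,
      |P.eval x - P.eval y| ≤ C * |x - y| := by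
    obtain ⟨C, hC⟩ := isCompact_Icc.exists_bound_of_continuousOn (s := Icc 0 t₁)
      (f := fun x => (Polynomial.derivative P).eval x) (Polynomial.continuous _).continuousOn
    refine ⟨C, fun x hx y hy => ?_⟩
    exact (convex_Icc 0 t₁).norm_image_sub_le_of_norm_hasDerivWithin_le
      (f := fun x => P.eval x) (fun z _ => (P.hasDerivAt z).hasDerivWithinAt) hC hy hx
  obtain ⟨L, hL, hLanti⟩ := hK.resolvent
  exact absurd (nonpos_of_volterra_isMin hK.integrableOn hK.nonneg hK.antitoneOn hK.continuousOn
    hL hLanti hPc hpos₁ hC (fun s hs => hmin ⟨hs.1, hs.2.trans ht₁.2⟩) (by linarith))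
    (not_le.2 hPt₁)

/-- Weak minimum principle: it is enough to control the source at the exit level. -/
theorem VolterraKernel.neg_le_volterra_of_eq (hK : VolterraKernel K) {h : ℝ → ℝ} {T c : ℝ}
    (hc : 0 ≤ c) (hh : ContinuousOn h (Icc 0 T))
    (hpos : ∀ t ∈ Icc 0 T, volterra K h t = -c → 0 < h t) :
    ∀ t ∈ Icc 0 T, -c ≤ volterra K h t := by
  intro t₂ ht₂
  have hT : 0 ≤ T := ht₂.1.trans ht₂.2
  by_contra! hlt
  set f := volterra K h with hf
  have hfc : ContinuousOn f (Icc 0 T) := continuousOn_volterra hK.integrableOn hT hh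
  -- the exit time
  set S : Set ℝ := {t | t ∈ Icc 0 T ∧ f t < -c} with hS
  have hSne : S.Nonempty := ⟨t₂, ht₂, hlt⟩
  have hSb : BddBelow S := ⟨0, fun t ht => ht.1.1⟩
  set t₀ := sInf S with ht₀
  have ht₀m : t₀ ∈ Icc 0 T :=
    ⟨le_csInf hSne fun t ht => ht.1.1, (csInf_le hSb ⟨ht₂, hlt⟩).trans ht₂.2⟩
  have hbefore : ∀ t ∈ Icc 0 T, t < t₀ → -c ≤ f t := fun t ht htt => by
    by_contra! h1
    exact not_lt.2 (csInf_le hSb ⟨ht, h1⟩) htt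
  have hle₀ : f t₀ ≤ -c := by
    have hcl : t₀ ∈ closure S := csInf_mem_closure hSne hSb
    have hmem : ContinuousWithinAt f S t₀ := (hfc t₀ ht₀m).mono fun t ht => ht.1
    have : (nhdsWithin t₀ S).NeBot := mem_closure_iff_nhdsWithin_neBot.1 hcl
    exact le_of_tendsto hmem (by filter_upwards [self_mem_nhdsWithin] with t ht using ht.2.le)
  have hge₀ : -c ≤ f t₀ := by
    rcases ht₀m.1.eq_or_lt with h0 | h0
    · rw [← h0, hf, volterra_zero]; linarith
    · have hca : ContinuousWithinAt f (Ico 0 t₀) t₀ :=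
        (hfc t₀ ht₀m).mono fun t ht => ⟨ht.1, ht.2.le.trans ht₀m.2⟩
      have hcl : t₀ ∈ closure (Ico 0 t₀) := by
        rw [closure_Ico h0.ne]; exact ⟨h0.le, le_rfl⟩
      have : (nhdsWithin t₀ (Ico 0 t₀)).NeBot := mem_closure_iff_nhdsWithin_neBot.1 hcl
      exact ge_of_tendsto hca (by
        filter_upwards [self_mem_nhdsWithin] with t ht
          using hbefore t ⟨ht.1, ht.2.le.trans ht₀m.2⟩ ht.2)
  have hh₀ : 0 < h t₀ := hpos t₀ ht₀m (le_antisymm hle₀ hge₀)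
  obtain ⟨η, hη, hηh⟩ : ∃ η > 0, ∀ t ∈ Icc 0 T, |t - t₀| < η → 0 < h t := by
    have := (hh t₀ ht₀m).eventually (lt_mem_nhds hh₀)
    obtain ⟨η, hη, h1⟩ := Metric.mem_nhdsWithin_iff.1 this
    exact ⟨η, hη, fun t ht h2 => h1 ⟨by rwa [Metric.mem_ball, Real.dist_eq], ht⟩⟩
  obtain ⟨t₃, ht₃S, ht₃⟩ := exists_lt_of_csInf_lt hSne (show sInf S < t₀ + η by linarith)
  have hge₃ : t₀ ≤ t₃ := csInf_le hSb ht₃S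
  -- On `[0, t₃]` the strict form applies: before `t₀`, `f ≤ -c` forces equality, and from `t₀` to
  -- `t₃` the source is positive by continuity.
  have := hK.neg_le_volterra_of_pos hc (hh.mono (Icc_subset_Icc_right ht₃S.1.2)) (T := t₃)
    (fun t ht hft => by
      have htT : t ∈ Icc 0 T := ⟨ht.1, ht.2.trans ht₃S.1.2⟩
      rcases lt_or_ge t t₀ with h1 | h1
      · exact hpos t htT (le_antisymm hft (hbefore t htT h1))
      · exact hηh t htT (abs_lt.2 ⟨by linarith, by linarith [ht.2]⟩)) t₃ ⟨ht₃S.1.1, le_rfl⟩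
  exact not_lt.2 this ht₃S.2

/-- Comparison principle for Volterra equations. -/
theorem VolterraKernel.neg_le_volterra (hK : VolterraKernel K) {h : ℝ → ℝ} {T c M : ℝ}
    (hc : 0 ≤ c) (hM : 0 ≤ M) (hh : ContinuousOn h (Icc 0 T))
    (hge : ∀ t ∈ Icc 0 T, volterra K h t ≤ -c → M * (volterra K h t + c) ≤ h t) :
    ∀ t ∈ Icc 0 T, -c ≤ volterra K h t := by
  intro t ht
  obtain ⟨μ, hμ0, hμ⟩ := exists_volterra_exp_le hK.integrableOn hK.nonneg M T hM
  set q : ℝ → ℝ := fun s => Real.exp (μ * s) with hq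
  have hqc : Continuous q := by fun_prop
  set e := volterra K q t with he
  have hkey : ∀ ε > 0, -c ≤ volterra K h t + ε * e := by
    intro ε hε
    have hsum : ∀ r ∈ Icc 0 T, volterra K (fun s => h s + ε * q s) r
        = volterra K h r + ε * volterra K q r := fun r hr => by
      rw [volterra_add hK.integrableOn hr.1 (hh.mono (Icc_subset_Icc_right hr.2)) (by fun_prop),
        volterra_const_mul]
    -- Where the perturbed convolution equals `-c`, `K ∗ h + c = -ε (K ∗ q)`, so `h ≥ -εM (K ∗ q) ≥
    -- -εq/2`, and the added `εq` makes the source positive.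
    have := hK.neg_le_volterra_of_eq hc (h := fun s => h s + ε * q s) (T := T)
      (by fun_prop) (fun r hr hr' => by
        rw [hsum r hr] at hr'
        have h1 : 0 ≤ volterra K q r :=
          volterra_nonneg hK.nonneg hr.1 fun s _ => (Real.exp_pos _).le
        have h2 := hge r hr (by nlinarith)
        have h3 := hμ r hr
        have h4 : 0 < q r := Real.exp_pos _
        have h5 : volterra K h r + c = -(ε * volterra K q r) := by linarith
        rw [h5] at h2
        have h6 := mul_le_mul_of_nonneg_left h3 hε.le
        have h7 := mul_pos hε h4
        change 0 < h r + ε * q r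
        change ε * (M * volterra K q r) ≤ ε * (q r / 2) at h6
        linarith) t ht
    rwa [hsum t ht] at this
  have hlim : Filter.Tendsto (fun ε : ℝ => volterra K h t + ε * e) (nhdsWithin 0 (Ioi 0))
      (nhds (volterra K h t + 0 * e)) :=
    Filter.Tendsto.mono_left (Continuous.tendsto (by fun_prop) 0) nhdsWithin_le_nhds
  rw [zero_mul, add_zero] at hlim
  exact ge_of_tendsto hlim (by filter_upwards [self_mem_nhdsWithin] with ε hε using hkey ε hε)

end MaximumPrinciple

/-! ### Bounds for the exponential on the left half-plane. -/

section ExpRemainder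

theorem Complex.norm_exp_sub_one_le_norm {ζ : ℂ} (hζ : ζ.re ≤ 0) : ‖Complex.exp ζ - 1‖ ≤ ‖ζ‖ := by
  have hconv : Convex ℝ {z : ℂ | z.re ≤ 0} := convex_halfSpace_re_le 0
  have := hconv.norm_image_sub_le_of_norm_hasDerivWithin_le (𝕜 := ℂ) (f := Complex.exp)
    (f' := Complex.exp) (C := 1) (fun z _ => (Complex.hasDerivAt_exp z).hasDerivWithinAt)
    (fun z hz => by rw [Complex.norm_exp]; exact Real.exp_le_one_iff.2 hz)
    (x := 0) (y := ζ) (by simp) hζ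
  simpa using this

/-- The second order remainder `e^ζ - 1 - ζ` of the exponential. -/
noncomputable def expRem (ζ : ℂ) : ℂ := Complex.exp ζ - 1 - ζ

/-- Mean value inequality on a convex half-disc, where the derivative `e^z - 1` is at most `‖z‖ ≤
r`. -/
theorem norm_expRem_sub_le {r : ℝ} {ζ ξ : ℂ} (hζ : ζ.re ≤ 0) (hξ : ξ.re ≤ 0) (hζr : ‖ζ‖ ≤ r)
    (hξr : ‖ξ‖ ≤ r) : ‖expRem ζ - expRem ξ‖ ≤ r * ‖ζ - ξ‖ := by
  have hconv : Convex ℝ ({z : ℂ | z.re ≤ 0} ∩ Metric.closedBall 0 r) :=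
    (convex_halfSpace_re_le 0).inter (convex_closedBall 0 r)
  exact hconv.norm_image_sub_le_of_norm_hasDerivWithin_le (𝕜 := ℂ) (f := expRem)
    (f' := fun z => Complex.exp z - 1) (C := r)
    (fun z _ => (((Complex.hasDerivAt_exp z).sub_const 1).sub (hasDerivAt_id z)).hasDerivWithinAt)
    (fun z hz => (Complex.norm_exp_sub_one_le_norm hz.1).trans (by simpa using hz.2))
    (x := ξ) (y := ζ) ⟨hξ, by simpa using hξr⟩ ⟨hζ, by simpa using hζr⟩

theorem norm_expRem_le {ζ : ℂ} (hζ : ζ.re ≤ 0) : ‖expRem ζ‖ ≤ ‖ζ‖ ^ 2 := by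
  have := norm_expRem_sub_le hζ (show (0 : ℂ).re ≤ 0 by simp) le_rfl (by simp)
  simpa [expRem, sq] using this

theorem Real.exp_neg_sub_le_sq {s : ℝ} (hs : 0 ≤ s) : Real.exp (-s) - 1 + s ≤ s ^ 2 := by
  have h1 := norm_expRem_le (ζ := ((-s : ℝ) : ℂ)) (by simpa using hs)
  have h2 : expRem ((-s : ℝ) : ℂ) = ((Real.exp (-s) - 1 + s : ℝ) : ℂ) := by
    simp [expRem]
  rw [h2, Complex.norm_real, Complex.norm_real, Real.norm_eq_abs, Real.norm_eq_abs, sq_abs,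
    neg_sq] at h1
  exact (le_abs_self _).trans h1

end ExpRemainder

/-! ### Regularity, sign and growth of the Riccati nonlinearity. -/

section RiccatiF

/-- The standing assumptions on the coefficients of the Riccati nonlinearity. -/
structure RiccatiHypothesis (c ρ Λ : ℝ) (ν : Measure ℝ) : Prop where
  c_pos : 0 < c
  rho_mem : ρ ∈ Icc (-1 : ℝ) 1
  Lambda_nonneg : 0 ≤ Λ
  null : ν (Iic 0) = 0
  integrable_sq : Integrable (fun z : ℝ => z ^ 2) ν

/-- The integrand in the jump part of `riccatiF`. -/
noncomputable def riccatiJump (Λ : ℝ) (u v : ℂ) (z : ℝ) : ℂ :=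
  Complex.exp ((v - (Λ : ℂ) * u) * (z : ℂ))
    - u * (Complex.exp (-(Λ : ℂ) * (z : ℂ)) - 1) - 1 - v * (z : ℂ)

/-- All terms linear in `z` cancel, so the integrand is `O(z²)` and second moments of `ν` suffice.
-/
theorem riccatiJump_eq (Λ : ℝ) (u v : ℂ) (z : ℝ) :
    riccatiJump Λ u v z
      = expRem ((v - (Λ : ℂ) * u) * (z : ℂ)) - u * expRem (-(Λ : ℂ) * (z : ℂ)) := by
  simp only [riccatiJump, expRem]; ring

theorem exp_neg_ofReal_mul (Λ z : ℝ) :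
    Complex.exp (-(Λ : ℂ) * (z : ℂ)) = ((Real.exp (-(Λ * z)) : ℝ) : ℂ) := by
  push_cast; ring_nf

theorem riccatiJump_re (Λ : ℝ) (u v : ℂ) (z : ℝ) : (riccatiJump Λ u v z).re
    = Real.exp ((v.re - Λ * u.re) * z) * Real.cos ((v.im - Λ * u.im) * z)
      - u.re * (Real.exp (-(Λ * z)) - 1) - 1 - v.re * z := by
  rw [riccatiJump, exp_neg_ofReal_mul]
  simp [Complex.exp_re, -Complex.ofReal_exp, ← Complex.ofReal_one, -Complex.ofReal_neg]

theorem riccatiJump_im (Λ : ℝ) (u v : ℂ) (z : ℝ) : (riccatiJump Λ u v z).im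
    = Real.exp ((v.re - Λ * u.re) * z) * Real.sin ((v.im - Λ * u.im) * z)
      - u.im * (Real.exp (-(Λ * z)) - 1) - v.im * z := by
  rw [riccatiJump, exp_neg_ofReal_mul]
  simp [Complex.exp_im, -Complex.ofReal_exp, ← Complex.ofReal_one, -Complex.ofReal_neg]

variable {b c ρ Λ : ℝ} {ν : Measure ℝ}

theorem RiccatiHypothesis.ae_pos (hF : RiccatiHypothesis c ρ Λ ν) : ∀ᵐ z ∂ν, 0 < z := by
  have : {z : ℝ | ¬ 0 < z} = Iic 0 := by ext; simp
  rw [ae_iff, this, hF.null]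

theorem RiccatiHypothesis.integrable_expRem (hF : RiccatiHypothesis c ρ Λ ν) {a : ℂ}
    (ha : a.re ≤ 0) : Integrable (fun z : ℝ => expRem (a * (z : ℂ))) ν := by
  refine (hF.integrable_sq.const_mul (‖a‖ ^ 2)).mono' ?_ ?_
  · refine Continuous.aestronglyMeasurable ?_
    unfold expRem
    fun_prop
  · filter_upwards [hF.ae_pos] with z hz
    refine (norm_expRem_le ?_).trans (le_of_eq ?_)
    · simpa using mul_nonpos_of_nonpos_of_nonneg ha hz.le
    · rw [norm_mul, Complex.norm_real, Real.norm_eq_abs, mul_pow, sq_abs]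

theorem RiccatiHypothesis.re_sub_nonpos (hF : RiccatiHypothesis c ρ Λ ν) {u v : ℂ}
    (hu : 0 ≤ u.re) (hv : v.re ≤ 0) : (v - (Λ : ℂ) * u).re ≤ 0 := by
  have := mul_nonneg hF.Lambda_nonneg hu
  simp only [Complex.sub_re, Complex.mul_re, Complex.ofReal_re, Complex.ofReal_im, zero_mul,
    sub_zero]
  linarith

theorem RiccatiHypothesis.integrable_jump (hF : RiccatiHypothesis c ρ Λ ν) {u v : ℂ}
    (hu : 0 ≤ u.re) (hv : v.re ≤ 0) : Integrable (riccatiJump Λ u v) ν := by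
  have h1 := hF.integrable_expRem (hF.re_sub_nonpos hu hv)
  have h2 := (hF.integrable_expRem (a := -(Λ : ℂ)) (by simpa using hF.Lambda_nonneg)).const_mul u
  exact (h1.sub h2).congr (Filter.Eventually.of_forall fun z => (riccatiJump_eq Λ u v z).symm)

theorem riccatiF_eq (b c ρ Λ : ℝ) (ν : Measure ℝ) (u v : ℂ) :
    riccatiF b c ρ Λ ν u v = (1 / 2) * (u ^ 2 - u)
      + ((b : ℂ) + (ρ : ℂ) * (Real.sqrt c : ℂ) * u) * v + ((c : ℂ) / 2) * v ^ 2
      + ∫ z, riccatiJump Λ u v z ∂ν := rfl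

theorem RiccatiHypothesis.re_integral_jump (hF : RiccatiHypothesis c ρ Λ ν) {u v : ℂ}
    (hu : 0 ≤ u.re) (hv : v.re ≤ 0) :
    (∫ z, riccatiJump Λ u v z ∂ν).re = ∫ z, (riccatiJump Λ u v z).re ∂ν :=
  (Complex.reCLM.integral_comp_comm (hF.integrable_jump hu hv)).symm

theorem RiccatiHypothesis.im_integral_jump (hF : RiccatiHypothesis c ρ Λ ν) {u v : ℂ}
    (hu : 0 ≤ u.re) (hv : v.re ≤ 0) :
    (∫ z, riccatiJump Λ u v z ∂ν).im = ∫ z, (riccatiJump Λ u v z).im ∂ν :=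
  (Complex.imCLM.integral_comp_comm (hF.integrable_jump hu hv)).symm

theorem riccatiF_re (b c ρ Λ : ℝ) (ν : Measure ℝ) (u v : ℂ) :
    (riccatiF b c ρ Λ ν u v).re = (1 / 2) * (u.re ^ 2 - u.im ^ 2 - u.re)
      + (b + ρ * √c * u.re) * v.re - ρ * √c * u.im * v.im + c / 2 * (v.re ^ 2 - v.im ^ 2)
      + (∫ z, riccatiJump Λ u v z ∂ν).re := by
  rw [riccatiF_eq, show (1 / 2 : ℂ) = ((1 / 2 : ℝ) : ℂ) by push_cast; rfl,
    show (c : ℂ) / 2 = ((c / 2 : ℝ) : ℂ) by push_cast; rfl]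
  simp only [Complex.add_re, Complex.mul_re, Complex.add_im,
    Complex.sub_re, Complex.ofReal_re, Complex.ofReal_im, Complex.mul_im, sq]
  ring

theorem riccatiF_im (b c ρ Λ : ℝ) (ν : Measure ℝ) (u v : ℂ) :
    (riccatiF b c ρ Λ ν u v).im = u.im * (u.re - 1 / 2)
      + (b + ρ * √c * u.re) * v.im + ρ * √c * u.im * v.re + c * v.re * v.im
      + (∫ z, riccatiJump Λ u v z ∂ν).im := by
  rw [riccatiF_eq, show (1 / 2 : ℂ) = ((1 / 2 : ℝ) : ℂ) by push_cast; rfl,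
    show (c : ℂ) / 2 = ((c / 2 : ℝ) : ℂ) by push_cast; rfl]
  simp only [Complex.add_im, Complex.mul_im, Complex.add_re,
    Complex.sub_im, Complex.ofReal_re, Complex.ofReal_im, Complex.mul_re, sq]
  ring

/-- This symmetry turns upper bounds on imaginary parts into lower bounds, and shows that solutions
for real `w` are real. -/
theorem riccatiF_conj (b c ρ Λ : ℝ) (ν : Measure ℝ) (u v : ℂ) :
    riccatiF b c ρ Λ ν (starRingEnd ℂ u) (starRingEnd ℂ v)
      = starRingEnd ℂ (riccatiF b c ρ Λ ν u v) := by
  have hj : ∀ z, riccatiJump Λ (starRingEnd ℂ u) (starRingEnd ℂ v) z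
      = starRingEnd ℂ (riccatiJump Λ u v z) := fun z => by
    simp [riccatiJump, ← Complex.exp_conj]
  simp only [riccatiF_eq, hj, integral_conj]
  simp [map_ofNat]

/-- `riccatiF` is Lipschitz in `v` on bounded subsets of the left half-plane. -/
theorem RiccatiHypothesis.exists_lipschitz (hF : RiccatiHypothesis c ρ Λ ν) (b : ℝ) {u : ℂ}
    (hu : 0 ≤ u.re) (R : ℝ) (hR : 0 ≤ R) : ∃ M, 0 ≤ M ∧ ∀ v v' : ℂ, v.re ≤ 0 → v'.re ≤ 0 →
      ‖v‖ ≤ R → ‖v'‖ ≤ R →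
      ‖riccatiF b c ρ Λ ν u v - riccatiF b c ρ Λ ν u v'‖ ≤ M * ‖v - v'‖ := by
  set m := ∫ z, z ^ 2 ∂ν with hm
  have hm0 : 0 ≤ m := integral_nonneg fun z => sq_nonneg z
  set D := ‖(b : ℂ) + (ρ : ℂ) * (Real.sqrt c : ℂ) * u‖ with hD
  have hΛ := hF.Lambda_nonneg
  have hcp := hF.c_pos
  -- The three summands come from the linear, quadratic and jump terms.
  refine ⟨D + c * R + (R + Λ * ‖u‖) * m, by positivity, fun v v' hv hv' hvR hvR' => ?_⟩
  have e : riccatiF b c ρ Λ ν u v - riccatiF b c ρ Λ ν u v'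
      = ((b : ℂ) + (ρ : ℂ) * (Real.sqrt c : ℂ) * u) * (v - v')
        + ((c / 2 : ℝ) : ℂ) * (v + v') * (v - v')
        + ∫ z, (riccatiJump Λ u v z - riccatiJump Λ u v' z) ∂ν := by
    rw [integral_sub (hF.integrable_jump hu hv) (hF.integrable_jump hu hv'), riccatiF_eq,
      riccatiF_eq]
    push_cast
    ring
  have hshift : ∀ v : ℂ, ‖v‖ ≤ R → ‖v - (Λ : ℂ) * u‖ ≤ R + Λ * ‖u‖ := fun v hv => by
    refine (norm_sub_le _ _).trans (add_le_add hv (le_of_eq ?_))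
    rw [norm_mul, Complex.norm_real, Real.norm_of_nonneg hΛ]
  have hint : ‖∫ z, (riccatiJump Λ u v z - riccatiJump Λ u v' z) ∂ν‖
      ≤ ∫ z, (R + Λ * ‖u‖) * ‖v - v'‖ * z ^ 2 ∂ν := by
    refine norm_integral_le_of_norm_le (hF.integrable_sq.const_mul _) ?_
    filter_upwards [hF.ae_pos] with z hz
    rw [riccatiJump_eq, riccatiJump_eq, sub_sub_sub_cancel_right]
    have hre : ∀ v : ℂ, v.re ≤ 0 → ((v - (Λ : ℂ) * u) * (z : ℂ)).re ≤ 0 := fun v hv => by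
      rw [Complex.re_mul_ofReal]
      exact mul_nonpos_of_nonpos_of_nonneg (hF.re_sub_nonpos hu hv) hz.le
    have hno : ∀ v : ℂ, ‖v‖ ≤ R → ‖(v - (Λ : ℂ) * u) * (z : ℂ)‖ ≤ (R + Λ * ‖u‖) * z :=
      fun v hv => by
        rw [norm_mul, Complex.norm_real, Real.norm_of_nonneg hz.le]
        exact mul_le_mul_of_nonneg_right (hshift v hv) hz.le
    refine (norm_expRem_sub_le (hre v hv) (hre v' hv') (hno v hvR) (hno v' hvR')).trans
      (le_of_eq ?_)
    rw [← sub_mul, sub_sub_sub_cancel_right, norm_mul, Complex.norm_real,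
      Real.norm_of_nonneg hz.le]
    ring
  rw [integral_const_mul] at hint
  rw [e]
  refine (norm_add₃_le).trans ?_
  have h2 : ‖((c / 2 : ℝ) : ℂ) * (v + v') * (v - v')‖ ≤ c * R * ‖v - v'‖ := by
    rw [norm_mul, norm_mul, Complex.norm_real, Real.norm_of_nonneg (by positivity)]
    refine mul_le_mul_of_nonneg_right ?_ (norm_nonneg _)
    have := (norm_add_le v v').trans (add_le_add hvR hvR')
    nlinarith
  rw [norm_mul]
  change D * ‖v - v'‖ + _ + _ ≤ _
  linarith

/-- The real part of `riccatiF` increases when `w` and `v` are replaced by their real parts. -/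
theorem RiccatiHypothesis.re_le (hF : RiccatiHypothesis c ρ Λ ν) (b : ℝ) {w v : ℂ}
    (hw : 0 ≤ w.re) (hv : v.re ≤ 0) :
    (riccatiF b c ρ Λ ν w v).re ≤ (riccatiF b c ρ Λ ν (w.re : ℂ) (v.re : ℂ)).re := by
  have hw' : 0 ≤ ((w.re : ℝ) : ℂ).re := hw
  have hv' : ((v.re : ℝ) : ℂ).re ≤ 0 := hv
  have hjump : (∫ z, riccatiJump Λ w v z ∂ν).re
      ≤ (∫ z, riccatiJump Λ (w.re : ℂ) (v.re : ℂ) z ∂ν).re := by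
    rw [hF.re_integral_jump hw hv, hF.re_integral_jump hw' hv']
    refine integral_mono (hF.integrable_jump hw hv).re (hF.integrable_jump hw' hv').re fun z => ?_
    change (riccatiJump Λ w v z).re ≤ (riccatiJump Λ (w.re : ℂ) (v.re : ℂ) z).re
    rw [riccatiJump_re, riccatiJump_re]
    simp only [Complex.ofReal_re, Complex.ofReal_im, mul_zero, sub_zero, zero_mul, Real.cos_zero,
      mul_one]
    have := mul_le_mul_of_nonneg_left (Real.cos_le_one ((v.im - Λ * w.im) * z))
      (Real.exp_pos ((v.re - Λ * w.re) * z)).le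
    linarith
  rw [riccatiF_re, riccatiF_re]
  simp only [Complex.ofReal_re, Complex.ofReal_im, mul_zero, sub_zero]
  have hs : √c ^ 2 = c := Real.sq_sqrt hF.c_pos.le
  have hρ : ρ ^ 2 ≤ 1 := by
    have := hF.rho_mem
    nlinarith [this.1, this.2]
  -- Twice what the non-jump terms lose through the imaginary parts; nonnegative as `(√c Im v + ρ Im
  -- w)² + (1 - ρ²)(Im w)²`.
  have hq : 0 ≤ w.im ^ 2 + 2 * (ρ * √c * w.im * v.im) + c * v.im ^ 2 := by
    have h1 := sq_nonneg (√c * v.im + ρ * w.im)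
    have h2 := mul_nonneg (sub_nonneg.2 hρ) (sq_nonneg w.im)
    have h3 : (√c * v.im) ^ 2 = c * v.im ^ 2 := by rw [mul_pow, hs]
    nlinarith
  linarith

/-- At `v = 0` there remain `(x² - x)/2` and the integral of `e^{-Λxz} - x e^{-Λz} - (1 - x)`, which
is nonpositive by convexity of the exponential. -/
theorem RiccatiHypothesis.re_ofReal_zero_nonpos (hF : RiccatiHypothesis c ρ Λ ν) (b : ℝ) {x : ℝ}
    (hx : x ∈ Icc (0 : ℝ) 1) : (riccatiF b c ρ Λ ν (x : ℂ) 0).re ≤ 0 := by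
  rw [riccatiF_re, hF.re_integral_jump (by simpa using hx.1) (by simp)]
  have : ∫ z, (riccatiJump Λ (x : ℂ) 0 z).re ∂ν ≤ 0 := by
    refine integral_nonpos fun z => ?_
    change (riccatiJump Λ (x : ℂ) 0 z).re ≤ 0
    rw [riccatiJump_re]
    simp only [Complex.ofReal_re, Complex.ofReal_im, Complex.zero_re, Complex.zero_im, mul_zero,
      sub_zero, zero_mul, Real.cos_zero, mul_one, zero_sub]
    have h := convexOn_exp.2 (mem_univ (-(Λ * z))) (mem_univ 0) hx.1 (sub_nonneg.2 hx.2)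
      (by ring)
    simp only [smul_eq_mul, mul_zero, add_zero, Real.exp_zero, mul_one] at h
    rw [show -(Λ * x) * z = x * -(Λ * z) by ring]
    linarith
  simp only [Complex.ofReal_re, Complex.ofReal_im, Complex.zero_re, Complex.zero_im]
  nlinarith [hx.1, hx.2]

/-- The vector field `riccatiF` points into the left half-plane along the imaginary axis. -/
theorem RiccatiHypothesis.re_nonpos_of_re_eq_zero (hF : RiccatiHypothesis c ρ Λ ν) (b : ℝ)
    {w v : ℂ} (hw : w.re ∈ Icc (0 : ℝ) 1) (hv : v.re = 0) :
    (riccatiF b c ρ Λ ν w v).re ≤ 0 := by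
  have h1 := hF.re_le b hw.1 hv.le
  rw [hv, Complex.ofReal_zero] at h1
  exact h1.trans (hF.re_ofReal_zero_nonpos b hw)

/-- The imaginary part of `riccatiF` grows at most linearly above a threshold. -/
theorem RiccatiHypothesis.exists_im_le (hF : RiccatiHypothesis c ρ Λ ν) (b : ℝ) {w : ℂ}
    (hw : w.re ∈ Icc (0 : ℝ) 1) : ∃ c₀ C, 0 ≤ c₀ ∧ 0 ≤ C ∧ ∀ v : ℂ, v.re ≤ 0 → c₀ ≤ v.im →
      (riccatiF b c ρ Λ ν w v).im ≤ C * (1 + v.im) := by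
  set m := ∫ z, z ^ 2 ∂ν with hm
  have hm0 : 0 ≤ m := integral_nonneg fun z => sq_nonneg z
  have hΛ := hF.Lambda_nonneg
  have hsc : 0 < √c := Real.sqrt_pos.2 hF.c_pos
  have hs : √c * √c = c := Real.mul_self_sqrt hF.c_pos.le
  -- The first part of the threshold makes `Im (v - Λw) ≥ 0`, so that `sin y ≤ y` applies in the
  -- jump term. The second makes `√c Im v + ρ Im w ≥ 0`; multiplied by `√c Re v ≤ 0`, this disposes
  -- of the terms containing `c Re v Im v`.
  refine ⟨Λ * |w.im| + |w.im| / √c, |w.im| * (1 + Λ ^ 2 * m) + |b| + √c, by positivity,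
    by positivity, fun v hv hvi => ?_⟩
  have hvi0 : 0 ≤ v.im := le_trans (by positivity) hvi
  have hy1 : Λ * w.im ≤ v.im :=
    (mul_le_mul_of_nonneg_left (le_abs_self _) hΛ).trans
      (le_trans (le_add_of_nonneg_right (by positivity)) hvi)
  have hρ : |ρ| ≤ 1 := abs_le.2 hF.rho_mem
  have hy2 : 0 ≤ √c * v.im + ρ * w.im := by
    have h1 : |w.im| / √c ≤ v.im := le_trans (le_add_of_nonneg_left (by positivity)) hvi
    rw [div_le_iff₀ hsc] at h1
    have h2 : |ρ * w.im| ≤ |w.im| := by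
      rw [abs_mul]; exact mul_le_of_le_one_left (abs_nonneg _) hρ
    linarith [neg_abs_le (ρ * w.im)]
  have hjump : (∫ z, riccatiJump Λ w v z ∂ν).im ≤ |w.im| * Λ ^ 2 * m := by
    rw [hF.im_integral_jump hw.1 hv, hm, ← integral_const_mul]
    refine integral_mono_ae (hF.integrable_jump hw.1 hv).im (hF.integrable_sq.const_mul _) ?_
    filter_upwards [hF.ae_pos] with z hz
    change (riccatiJump Λ w v z).im ≤ _
    rw [riccatiJump_im]
    have h1 : 0 ≤ (v.im - Λ * w.im) * z := mul_nonneg (sub_nonneg.2 hy1) hz.le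
    have h2 : Real.exp ((v.re - Λ * w.re) * z) ≤ 1 := by
      refine Real.exp_le_one_iff.2 (mul_nonpos_of_nonpos_of_nonneg ?_ hz.le)
      linarith [mul_nonneg hΛ hw.1]
    have h3 : Real.exp ((v.re - Λ * w.re) * z) * Real.sin ((v.im - Λ * w.im) * z)
        ≤ (v.im - Λ * w.im) * z :=
      (mul_le_mul_of_nonneg_left (Real.sin_le h1) (Real.exp_pos _).le).trans
        (mul_le_of_le_one_left h1 h2)
    have h4 : -(w.im * (Real.exp (-(Λ * z)) - 1 + Λ * z)) ≤ |w.im| * (Λ * z) ^ 2 := by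
      have h5 := Real.exp_neg_sub_le_sq (mul_nonneg hΛ hz.le)
      have h6 : 0 ≤ Real.exp (-(Λ * z)) - 1 + Λ * z := by
        linarith [Real.add_one_le_exp (-(Λ * z))]
      calc _ = -w.im * (Real.exp (-(Λ * z)) - 1 + Λ * z) := by ring
        _ ≤ |w.im| * (Real.exp (-(Λ * z)) - 1 + Λ * z) :=
          mul_le_mul_of_nonneg_right (neg_le_abs _) h6
        _ ≤ _ := mul_le_mul_of_nonneg_left h5 (abs_nonneg _)
    rw [mul_pow] at h4
    linarith
  rw [riccatiF_im]
  have t1 : w.im * (w.re - 1 / 2) ≤ |w.im| := by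
    refine (le_abs_self _).trans ?_
    rw [abs_mul]
    refine mul_le_of_le_one_right (abs_nonneg _) (abs_le.2 ⟨?_, ?_⟩) <;> linarith [hw.1, hw.2]
  have t2 : (b + ρ * √c * w.re) * v.im ≤ (|b| + √c) * v.im := by
    refine mul_le_mul_of_nonneg_right (add_le_add (le_abs_self b) ?_) hvi0
    have h1 : ρ * w.re ≤ 1 := by nlinarith [hF.rho_mem.2, hw.1, hw.2]
    nlinarith
  have t3 : ρ * √c * w.im * v.re + c * v.re * v.im ≤ 0 := by
    have h1 := mul_nonpos_of_nonpos_of_nonneg hv (mul_nonneg hsc.le hy2)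
    have h2 : v.re * (√c * (√c * v.im + ρ * w.im))
        = ρ * √c * w.im * v.re + (√c * √c) * v.re * v.im := by ring
    rw [hs] at h2
    linarith
  have t4 : 0 ≤ |w.im| * (1 + Λ ^ 2 * m) * v.im := by positivity
  have t5 : 0 ≤ |b| + √c := by positivity
  linarith

/-- The real part of `riccatiF` decreases at most linearly on horizontal strips. -/
theorem RiccatiHypothesis.exists_le_re (hF : RiccatiHypothesis c ρ Λ ν) (b : ℝ) {w : ℂ}
    (hw : w.re ∈ Icc (0 : ℝ) 1) (B : ℝ) : ∃ C, 0 ≤ C ∧ ∀ v : ℂ, v.re ≤ 0 → |v.im| ≤ B →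
      -(C * (1 - v.re)) ≤ (riccatiF b c ρ Λ ν w v).re := by
  set m := ∫ z, z ^ 2 ∂ν with hm
  have hm0 : 0 ≤ m := integral_nonneg fun z => sq_nonneg z
  have hΛ := hF.Lambda_nonneg
  have hcp := hF.c_pos
  set g := |B| + Λ * |w.im| with hg
  refine ⟨1 + w.im ^ 2 + |b| + |ρ * √c| + |ρ * √c * w.im| * |B| + c * B ^ 2
    + (g ^ 2 + Λ ^ 2) * m, by positivity, fun v hv hvB => ?_⟩
  have hBB : |v.im| ≤ |B| := hvB.trans (le_abs_self B)
  have hγ : (v.im - Λ * w.im) ^ 2 ≤ g ^ 2 := by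
    refine sq_le_sq' ?_ ?_
    · have h1 := mul_le_mul_of_nonneg_left (le_abs_self w.im) hΛ
      linarith [neg_abs_le v.im]
    · have h1 := mul_le_mul_of_nonneg_left (neg_abs_le w.im) hΛ
      linarith [le_abs_self v.im]
  have hjump : -((g ^ 2 + Λ ^ 2) * m) ≤ (∫ z, riccatiJump Λ w v z ∂ν).re := by
    rw [hF.re_integral_jump hw.1 hv, hm, ← integral_const_mul, ← integral_neg]
    refine integral_mono_ae (hF.integrable_sq.const_mul _).neg (hF.integrable_jump hw.1 hv).re ?_
    filter_upwards [hF.ae_pos] with z hz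
    change _ ≤ (riccatiJump Λ w v z).re
    rw [riccatiJump_re]
    set θ := (v.im - Λ * w.im) * z with hθ
    set s := (v.re - Λ * w.re) * z with hs
    have h1 : Real.exp s ≤ 1 := by
      refine Real.exp_le_one_iff.2 (mul_nonpos_of_nonpos_of_nonneg ?_ hz.le)
      linarith [mul_nonneg hΛ hw.1]
    -- Together with `1 + s ≤ e^s ≤ 1` this gives `e^s cos θ ≥ 1 + s - θ²/2`, whose linear part
    -- cancels against `Re v · z` and the compensator.
    have h2 := mul_le_mul_of_nonneg_left (Real.one_sub_sq_div_two_le_cos (x := θ))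
      (Real.exp_pos s).le
    have h3 := mul_le_mul_of_nonneg_right h1 (sq_nonneg θ)
    have h4 := Real.add_one_le_exp s
    have h5 : θ ^ 2 ≤ g ^ 2 * z ^ 2 := by
      rw [hθ, mul_pow]; exact mul_le_mul_of_nonneg_right hγ (sq_nonneg z)
    have h6 : w.re * (Real.exp (-(Λ * z)) - 1 + Λ * z) ≤ (Λ * z) ^ 2 := by
      have h7 := Real.exp_neg_sub_le_sq (mul_nonneg hΛ hz.le)
      have h8 : 0 ≤ Real.exp (-(Λ * z)) - 1 + Λ * z := by
        linarith [Real.add_one_le_exp (-(Λ * z))]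
      exact (mul_le_of_le_one_left h8 hw.2).trans h7
    rw [mul_pow] at h6
    have h9 : 0 ≤ g ^ 2 * z ^ 2 := by positivity
    linarith
  rw [riccatiF_re]
  have t1 : -(1 + w.im ^ 2) ≤ (1 / 2) * (w.re ^ 2 - w.im ^ 2 - w.re) := by
    nlinarith [hw.1, hw.2, sq_nonneg w.re, sq_nonneg w.im]
  have t2 : -((|b| + |ρ * √c|) * -v.re) ≤ (b + ρ * √c * w.re) * v.re := by
    have h1 : b + ρ * √c * w.re ≤ |b| + |ρ * √c| := by
      refine add_le_add (le_abs_self b) ((le_abs_self _).trans ?_)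
      rw [abs_mul, abs_of_nonneg hw.1]
      exact mul_le_of_le_one_right (abs_nonneg _) hw.2
    nlinarith
  have t3 : ρ * √c * w.im * v.im ≤ |ρ * √c * w.im| * |B| := by
    refine (le_abs_self _).trans ?_
    rw [abs_mul]
    exact mul_le_mul_of_nonneg_left hBB (abs_nonneg _)
  have t4 : v.im ^ 2 ≤ B ^ 2 := sq_le_sq.2 hBB
  have t5 : -(c * B ^ 2) ≤ c / 2 * (v.re ^ 2 - v.im ^ 2) := by
    nlinarith [mul_le_mul_of_nonneg_left t4 hcp.le, mul_nonneg hcp.le (sq_nonneg v.re),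
      mul_nonneg hcp.le (sq_nonneg v.im)]
  have t6 : 0 ≤ (1 + w.im ^ 2 + |ρ * √c * w.im| * |B| + c * B ^ 2 + (g ^ 2 + Λ ^ 2) * m) * -v.re :=
    mul_nonneg (by positivity) (by linarith)
  have t7 : 0 ≤ |b| + |ρ * √c| := by positivity
  linarith

end RiccatiF

/-! ### Truncation to a box in the left half-plane. -/

section Truncation

/-- Truncation of a complex number to the box `[-R, 0] × [-R, R]`. -/
noncomputable def boxTrunc (R : ℝ) (v : ℂ) : ℂ := ⟨max (-R) (min v.re 0), max (-R) (min v.im R)⟩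

variable {R : ℝ}

theorem boxTrunc_re_nonpos (hR : 0 ≤ R) (v : ℂ) : (boxTrunc R v).re ≤ 0 :=
  max_le (neg_nonpos.2 hR) (min_le_right _ _)

theorem norm_boxTrunc_le (hR : 0 ≤ R) (v : ℂ) : ‖boxTrunc R v‖ ≤ 2 * R := by
  refine (Complex.norm_le_abs_re_add_abs_im _).trans ?_
  have h1 : |(boxTrunc R v).re| ≤ R :=
    abs_le.2 ⟨le_max_left _ _, (boxTrunc_re_nonpos hR v).trans hR⟩
  have h2 : |(boxTrunc R v).im| ≤ R :=
    abs_le.2 ⟨le_max_left _ _, max_le (by linarith) (min_le_right _ _)⟩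
  linarith

theorem norm_boxTrunc_sub_le (v v' : ℂ) : ‖boxTrunc R v - boxTrunc R v'‖ ≤ 2 * ‖v - v'‖ := by
  have key : ∀ a x y r : ℝ, |max a (min x r) - max a (min y r)| ≤ |x - y| := fun a x y r => by
    have h1 := abs_max_sub_max_le_max a (min x r) a (min y r)
    have h2 := abs_min_sub_min_le_max x r y r
    simp only [sub_self, abs_zero] at h1 h2
    rw [max_eq_right (abs_nonneg (min x r - min y r))] at h1
    rw [max_eq_left (abs_nonneg (x - y))] at h2
    exact h1.trans h2
  refine (Complex.norm_le_abs_re_add_abs_im _).trans ?_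
  have h1 := (key (-R) v.re v'.re 0).trans (Complex.abs_re_le_norm (v - v'))
  have h2 := (key (-R) v.im v'.im R).trans (Complex.abs_im_le_norm (v - v'))
  rw [two_mul]
  exact add_le_add h1 h2

theorem boxTrunc_eq_self {v : ℂ} (h1 : -R ≤ v.re) (h2 : v.re ≤ 0) (h3 : |v.im| ≤ R) :
    boxTrunc R v = v := by
  obtain ⟨h4, h5⟩ := abs_le.1 h3
  apply Complex.ext <;> simp [boxTrunc, *]

/-- Together with `le_boxTrunc_re`, this lets the growth bounds on `riccatiF` pass to the truncated
field with constants independent of `R`. -/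
theorem abs_boxTrunc_im_le (hR : 0 ≤ R) (v : ℂ) : |(boxTrunc R v).im| ≤ |v.im| := by
  simp only [boxTrunc]
  refine abs_le.2 ⟨?_, ?_⟩
  · exact le_max_of_le_right (le_min (neg_abs_le _) (by linarith [abs_nonneg v.im]))
  · exact max_le (by linarith [abs_nonneg v.im]) ((min_le_left _ _).trans (le_abs_self _))

theorem le_boxTrunc_re {v : ℂ} (hv : v.re ≤ 0) : v.re ≤ (boxTrunc R v).re :=
  le_max_of_le_right (le_min le_rfl hv)

theorem boxTrunc_re_of_nonneg (hR : 0 ≤ R) {v : ℂ} (hv : 0 ≤ v.re) : (boxTrunc R v).re = 0 := by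
  simp [boxTrunc, hv, hR]

end Truncation

/-! ### An a priori upper bound from one-sided linear growth. -/

section APriori

variable {K : ℝ → ℝ}

/-- Solutions of Volterra equations whose source grows at most linearly above a threshold are
bounded above. -/
theorem VolterraKernel.exists_upper_bound (hK : VolterraKernel K) {T C c₀ : ℝ} (hT : 0 ≤ T)
    (hC : 0 ≤ C) (hc₀ : 0 ≤ c₀) : ∃ B, ∀ χ g : ℝ → ℝ, ContinuousOn g (Icc 0 T) →
      (∀ t ∈ Icc 0 T, χ t = volterra K g t) →
      (∀ t ∈ Icc 0 T, c₀ ≤ χ t → g t ≤ C * (1 + χ t)) → ∀ t ∈ Icc 0 T, χ t ≤ B := by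
  obtain ⟨μ, hμ0, hμ⟩ := exists_volterra_exp_le hK.integrableOn hK.nonneg C T hC
  set A := 2 * C * (1 + c₀) with hA
  have hA0 : 0 ≤ A := by positivity
  set q : ℝ → ℝ := fun s => A * Real.exp (μ * s) with hq
  have hqc : Continuous q := by fun_prop
  obtain ⟨B, hB⟩ := isCompact_Icc.exists_bound_of_continuousOn
    (continuousOn_volterra hK.integrableOn hT (hqc.continuousOn (s := Icc 0 T)))
  refine ⟨c₀ + B, fun χ g hg hχ hgle t ht => ?_⟩
  have hsub : ∀ r ∈ Icc 0 T, volterra K (fun s => q s - g s) r = volterra K q r - χ r :=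
    fun r hr => by
      rw [hχ r hr, volterra_sub hK.integrableOn hr.1 hqc.continuousOn
        (hg.mono (Icc_subset_Icc_right hr.2))]
  -- The barrier is `c₀ + K ∗ q`. Half of `q` dominates `C (K ∗ q)` by the choice of `μ`, the other
  -- half dominates `C (1 + c₀) = A/2`.
  have := hK.neg_le_volterra hc₀ hC (h := fun s => q s - g s) (T := T)
    (hqc.continuousOn.sub hg) (fun r hr hle => by
      rw [hsub r hr] at hle ⊢
      have h1 : 0 ≤ volterra K q r := volterra_nonneg hK.nonneg hr.1
        fun s _ => mul_nonneg hA0 (Real.exp_pos _).le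
      have h2 := hgle r hr (by linarith)
      have h3 := mul_le_mul_of_nonneg_left (hμ r hr) hA0
      have h4 : volterra K q r = A * volterra K (fun s => Real.exp (μ * s)) r :=
        volterra_const_mul _ _ _
      have h5 : A ≤ A * Real.exp (μ * r) :=
        le_mul_of_one_le_right hA0 (Real.one_le_exp (mul_nonneg hμ0 hr.1))
      have h6 : C * volterra K q r ≤ A * Real.exp (μ * r) / 2 := by rw [h4]; linarith
      have h7 : C * (1 + c₀) = A / 2 := by rw [hA]; ring
      change _ ≤ A * Real.exp (μ * r) - g r
      linarith) t ht
  rw [hsub t ht] at this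
  linarith [le_of_abs_le (hB t ht)]

end APriori

/-! ### Existence, uniqueness and comparison for the Riccati–Volterra equation. -/

section Solutions

variable {b c ρ Λ : ℝ} {ν : Measure ℝ} {K : ℝ → ℝ} {w : ℂ}

/-- Solutions of the Riccati–Volterra equation on a compact interval. -/
structure IsRiccatiSolutionOn (b c ρ Λ : ℝ) (ν : Measure ℝ) (K : ℝ → ℝ) (w : ℂ) (T : ℝ)
    (ψ : ℝ → ℂ) : Prop where
  continuousOn : ContinuousOn ψ (Icc 0 T)
  re_nonpos : ∀ t ∈ Icc 0 T, (ψ t).re ≤ 0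
  equation : ∀ t ∈ Icc 0 T, ψ t = volterra K (fun s => riccatiF b c ρ Λ ν w (ψ s)) t

theorem isRiccatiVolterraSolution_iff {ψ : ℝ → ℂ} :
    IsRiccatiVolterraSolution b c ρ Λ ν K w ψ ↔
      ∀ T, IsRiccatiSolutionOn b c ρ Λ ν K w T ψ := by
  have hv : ∀ t, volterra K (fun s => riccatiF b c ρ Λ ν w (ψ s)) t
      = ∫ s in (0 : ℝ)..t, ((K (t - s) : ℝ) : ℂ) * riccatiF b c ρ Λ ν w (ψ s) := fun t => by
    simp only [volterra, Complex.real_smul]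
  constructor
  · intro h T
    exact ⟨h.continuousOn.mono Icc_subset_Ici_self, fun t ht => h.re_nonpos t ht.1,
      fun t ht => by rw [hv]; exact h.equation t ht.1⟩
  · intro h
    refine ⟨fun t ht => ?_, fun t ht => (h t).re_nonpos t ⟨ht, le_rfl⟩,
      fun t ht => by rw [← hv]; exact (h t).equation t ⟨ht, le_rfl⟩⟩
    refine ((h (t + 1)).continuousOn t ⟨ht, by linarith⟩).mono_of_mem_nhdsWithin ?_
    rw [← Ici_inter_Iic]
    exact Filter.inter_mem self_mem_nhdsWithin (mem_nhdsWithin_of_mem_nhds (Iic_mem_nhds (by linarith)))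

theorem IsRiccatiSolutionOn.mono {T S : ℝ} {ψ : ℝ → ℂ}
    (h : IsRiccatiSolutionOn b c ρ Λ ν K w T ψ) (hST : S ≤ T) :
    IsRiccatiSolutionOn b c ρ Λ ν K w S ψ :=
  ⟨h.continuousOn.mono (Icc_subset_Icc_right hST), fun t ht => h.re_nonpos t ⟨ht.1, ht.2.trans hST⟩,
    fun t ht => h.equation t ⟨ht.1, ht.2.trans hST⟩⟩

theorem IsRiccatiSolutionOn.congr {T : ℝ} {ψ φ : ℝ → ℂ}
    (h : IsRiccatiSolutionOn b c ρ Λ ν K w T ψ) (hφ : EqOn φ ψ (Icc 0 T)) :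
    IsRiccatiSolutionOn b c ρ Λ ν K w T φ := by
  refine ⟨h.continuousOn.congr hφ, fun t ht => by rw [hφ ht]; exact h.re_nonpos t ht,
    fun t ht => ?_⟩
  rw [hφ ht, h.equation t ht]
  exact volterra_congr ht.1 fun s hs => by simp only [hφ ⟨hs.1, hs.2.trans ht.2⟩]

/-- A common Lipschitz constant for `riccatiF` along two continuous paths. -/
theorem RiccatiHypothesis.exists_lipschitz_along (hF : RiccatiHypothesis c ρ Λ ν) (b : ℝ)
    (hw : 0 ≤ w.re) {T : ℝ} {ψ φ : ℝ → ℂ} (hψ : ContinuousOn ψ (Icc 0 T))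
    (hφ : ContinuousOn φ (Icc 0 T)) (hψ0 : ∀ t ∈ Icc 0 T, (ψ t).re ≤ 0)
    (hφ0 : ∀ t ∈ Icc 0 T, (φ t).re ≤ 0) : ∃ M, 0 ≤ M ∧ ∀ s ∈ Icc 0 T, ∀ t ∈ Icc 0 T,
      ‖riccatiF b c ρ Λ ν w (ψ s) - riccatiF b c ρ Λ ν w (φ t)‖ ≤ M * ‖ψ s - φ t‖ := by
  obtain ⟨R₁, hR₁⟩ := isCompact_Icc.exists_bound_of_continuousOn hψ
  obtain ⟨R₂, hR₂⟩ := isCompact_Icc.exists_bound_of_continuousOn hφ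
  obtain ⟨M, hM, h⟩ := hF.exists_lipschitz b hw (max 0 (max R₁ R₂)) (le_max_left _ _)
  exact ⟨M, hM, fun s hs t ht => h _ _ (hψ0 s hs) (hφ0 t ht)
    ((hR₁ s hs).trans ((le_max_left _ _).trans (le_max_right _ _)))
    ((hR₂ t ht).trans ((le_max_right _ _).trans (le_max_right _ _)))⟩

theorem RiccatiHypothesis.continuousOn_comp (hF : RiccatiHypothesis c ρ Λ ν) (b : ℝ)
    (hw : 0 ≤ w.re) {T : ℝ} {ψ : ℝ → ℂ} (hψ : ContinuousOn ψ (Icc 0 T))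
    (hψ0 : ∀ t ∈ Icc 0 T, (ψ t).re ≤ 0) :
    ContinuousOn (fun s => riccatiF b c ρ Λ ν w (ψ s)) (Icc 0 T) := by
  obtain ⟨M, hM, h⟩ := hF.exists_lipschitz_along b hw hψ hψ hψ0 hψ0
  intro t ht
  have h1 : Filter.Tendsto (fun s => M * ‖ψ s - ψ t‖) (nhdsWithin t (Icc 0 T))
      (nhds (M * ‖ψ t - ψ t‖)) :=
    (((hψ t ht).sub continuousWithinAt_const).norm).const_mul M
  rw [sub_self, norm_zero, mul_zero] at h1
  rw [ContinuousWithinAt, tendsto_iff_norm_sub_tendsto_zero]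
  exact squeeze_zero' (Filter.Eventually.of_forall fun _ => norm_nonneg _)
    (by filter_upwards [self_mem_nhdsWithin] with s hs using h s hs t ht) h1

/-- Both paths stay in a bounded part of the left half-plane, where `riccatiF` is Lipschitz;
Gronwall with constant term `0` finishes. -/
theorem IsRiccatiSolutionOn.unique (hF : RiccatiHypothesis c ρ Λ ν) (hK : VolterraKernel K)
    (hw : 0 ≤ w.re) {T : ℝ} {ψ φ : ℝ → ℂ} (hψ : IsRiccatiSolutionOn b c ρ Λ ν K w T ψ)
    (hφ : IsRiccatiSolutionOn b c ρ Λ ν K w T φ) : EqOn φ ψ (Icc 0 T) := by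
  obtain ⟨M, hM, hL⟩ := hF.exists_lipschitz_along b hw hψ.continuousOn hφ.continuousOn
    hψ.re_nonpos hφ.re_nonpos
  obtain ⟨μ, hμ0, hμ⟩ := exists_volterra_exp_le hK.integrableOn hK.nonneg M T hM
  have hFψ := hF.continuousOn_comp b hw hψ.continuousOn hψ.re_nonpos
  have hFφ := hF.continuousOn_comp b hw hφ.continuousOn hφ.re_nonpos
  have hd : ContinuousOn (fun t => ‖ψ t - φ t‖) (Icc 0 T) :=
    (hψ.continuousOn.sub hφ.continuousOn).norm
  have := volterra_gronwall hK.integrableOn hK.nonneg hM hμ hμ0 le_rfl hd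
    (fun _ _ => norm_nonneg _) (fun t ht => by
      have hsub : Icc 0 t ⊆ Icc 0 T := Icc_subset_Icc_right ht.2
      rw [zero_add, ← volterra_const_mul]
      have h1 := norm_volterra_le hK.integrableOn hK.nonneg ht.1
        (h := fun s => riccatiF b c ρ Λ ν w (ψ s) - riccatiF b c ρ Λ ν w (φ s))
        (g := fun s => M * ‖ψ s - φ s‖) ((hFψ.sub hFφ).mono hsub)
        ((continuousOn_const.mul hd).mono hsub) (fun s hs => hL s (hsub hs) s (hsub hs))
      rwa [volterra_sub hK.integrableOn ht.1 (hFψ.mono hsub) (hFφ.mono hsub),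
        ← hψ.equation t ht, ← hφ.equation t ht] at h1)
  intro t ht
  have h1 := this t ht
  rw [mul_zero, zero_mul] at h1
  exact (sub_eq_zero.1 (norm_le_zero_iff.1 h1)).symm

/-- Two-sided linear growth of the imaginary part of `riccatiF`. -/
theorem RiccatiHypothesis.exists_abs_im_le (hF : RiccatiHypothesis c ρ Λ ν) (b : ℝ)
    (hw : w.re ∈ Icc (0 : ℝ) 1) : ∃ c₀ C, 0 ≤ c₀ ∧ 0 ≤ C ∧ ∀ v : ℂ, v.re ≤ 0 →
      (c₀ ≤ v.im → (riccatiF b c ρ Λ ν w v).im ≤ C * (1 + v.im)) ∧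
      (c₀ ≤ -v.im → -(riccatiF b c ρ Λ ν w v).im ≤ C * (1 + -v.im)) := by
  obtain ⟨c₁, C₁, hc₁, hC₁, h₁⟩ := hF.exists_im_le b hw
  obtain ⟨c₂, C₂, hc₂, hC₂, h₂⟩ := hF.exists_im_le b (w := starRingEnd ℂ w) (by simpa using hw)
  refine ⟨max c₁ c₂, max C₁ C₂, le_max_of_le_left hc₁, le_max_of_le_left hC₁,
    fun v hv => ⟨fun h => ?_, fun h => ?_⟩⟩
  · have h0 := (le_max_left _ _).trans h
    exact (h₁ v hv h0).trans
      (mul_le_mul_of_nonneg_right (le_max_left _ _) (by linarith))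
  · have h0 := (le_max_right _ _).trans h
    have h3 := h₂ (starRingEnd ℂ v) (by simpa using hv) (by simpa using h0)
    rw [riccatiF_conj, Complex.conj_im, Complex.conj_im] at h3
    exact h3.trans (mul_le_mul_of_nonneg_right (le_max_right _ _) (by linarith))

theorem exists_isRiccatiSolutionOn (hF : RiccatiHypothesis c ρ Λ ν) (hK : VolterraKernel K)
    (b : ℝ) (hw : w.re ∈ Icc (0 : ℝ) 1) {T : ℝ} (hT : 0 ≤ T) :
    ∃ ψ, IsRiccatiSolutionOn b c ρ Λ ν K w T ψ := by
  obtain ⟨c₀, C₀, hc₀, hC₀, him⟩ := hF.exists_abs_im_le b hw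
  -- The order of choices matters: `B` bounds the imaginary part, `C₁` depends on `B`, `A` bounds
  -- minus the real part, and the box size `R` exceeds them all. None of the bounds depends on `R`.
  obtain ⟨B, hB⟩ := hK.exists_upper_bound hT hC₀ hc₀
  obtain ⟨C₁, hC₁, hre⟩ := hF.exists_le_re b hw B
  obtain ⟨μ, hμ0, hμ⟩ := exists_volterra_exp_le hK.integrableOn hK.nonneg C₁ T hC₁
  set I := volterra K (fun _ => (1 : ℝ)) T with hI
  have hI0 : 0 ≤ I := volterra_nonneg hK.nonneg hT fun _ _ => zero_le_one
  set A := 2 * (C₁ * I) * Real.exp (μ * T) with hA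
  set R := max c₀ (max B A) with hR
  have hRc : c₀ ≤ R := le_max_left _ _
  have hRB : B ≤ R := (le_max_left _ _).trans (le_max_right _ _)
  have hRA : A ≤ R := (le_max_right _ _).trans (le_max_right _ _)
  have hR0 : 0 ≤ R := hc₀.trans hRc
  obtain ⟨M, hM, hL⟩ := hF.exists_lipschitz b hw.1 (2 * R) (by positivity)
  set G : ℂ → ℂ := fun v => riccatiF b c ρ Λ ν w (boxTrunc R v) with hG
  have hGL : ∀ x y, ‖G x - G y‖ ≤ M * 2 * ‖x - y‖ := fun x y => by
    refine (hL _ _ (boxTrunc_re_nonpos hR0 x) (boxTrunc_re_nonpos hR0 y) (norm_boxTrunc_le hR0 x)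
      (norm_boxTrunc_le hR0 y)).trans ?_
    rw [mul_assoc]
    exact mul_le_mul_of_nonneg_left (norm_boxTrunc_sub_le x y) hM
  have hGc : Continuous G :=
    (LipschitzWith.of_dist_le_mul (K := ⟨M * 2, by positivity⟩) fun x y => by
      rw [dist_eq_norm, dist_eq_norm]; exact hGL x y).continuous
  obtain ⟨ψ, hψc, hψ⟩ := exists_volterra_solution hK.integrableOn hK.nonneg hT
    (show 0 ≤ M * 2 by positivity) hGL
  have hGψ : Continuous fun s => G (ψ s) := hGc.comp hψc
  have hψre : ∀ t ∈ Icc 0 T, (ψ t).re = volterra K (fun s => (G (ψ s)).re) t := fun t ht => by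
    rw [hψ t ht]
    exact (volterra_clm Complex.reCLM hK.integrableOn ht.1 hGψ.continuousOn).symm
  have hψim : ∀ t ∈ Icc 0 T, (ψ t).im = volterra K (fun s => (G (ψ s)).im) t := fun t ht => by
    rw [hψ t ht]
    exact (volterra_clm Complex.imCLM hK.integrableOn ht.1 hGψ.continuousOn).symm
  have hGre : Continuous fun s => (G (ψ s)).re := Complex.continuous_re.comp hGψ
  have hGim : Continuous fun s => (G (ψ s)).im := Complex.continuous_im.comp hGψ
  have hneg : ∀ (g : ℝ → ℝ) (t : ℝ), volterra K (fun s => -g s) t = -volterra K g t :=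
    fun g t => by
      have := volterra_const_mul (K := K) (-1) g t
      simpa using this
  -- Where `Re ψ ≥ 0` the truncation lands on the imaginary axis, where the field points inwards.
  have hre0 : ∀ t ∈ Icc 0 T, (ψ t).re ≤ 0 := by
    have := hK.neg_le_volterra (c := 0) (M := 0) le_rfl le_rfl
      (h := fun s => -(G (ψ s)).re) (T := T) hGre.neg.continuousOn (fun t ht hle => by
        rw [hneg, ← hψre t ht] at hle
        rw [zero_mul]
        exact neg_nonneg.2 (hF.re_nonpos_of_re_eq_zero b hw
          (boxTrunc_re_of_nonneg hR0 (by linarith))))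
    intro t ht
    have h1 := this t ht
    rw [hneg, ← hψre t ht] at h1
    linarith
  have him1 : ∀ t ∈ Icc 0 T, (ψ t).im ≤ B := by
    refine hB (fun t => (ψ t).im) (fun s => (G (ψ s)).im) hGim.continuousOn hψim
      fun t ht hle => ?_
    -- Since `c₀ ≤ R`, a value above the threshold stays above it after truncation, so the growth
    -- bound still applies.
    have h1 : (boxTrunc R (ψ t)).im = min (ψ t).im R :=
      max_eq_right ((neg_nonpos.2 hR0).trans (hc₀.trans (le_min hle hRc)))
    have h2 := (him _ (boxTrunc_re_nonpos hR0 (ψ t))).1 (by rw [h1]; exact le_min hle hRc)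
    refine h2.trans (mul_le_mul_of_nonneg_left ?_ hC₀)
    rw [h1]
    linarith [min_le_left (ψ t).im R]
  have him2 : ∀ t ∈ Icc 0 T, -(ψ t).im ≤ B := by
    refine hB (fun t => -(ψ t).im) (fun s => -(G (ψ s)).im) hGim.neg.continuousOn
      (fun t ht => by rw [hneg, ← hψim t ht]) fun t ht hle => ?_
    have h0 : min (ψ t).im R = (ψ t).im := min_eq_left (by linarith)
    have h1 : (boxTrunc R (ψ t)).im = max (-R) (ψ t).im := by simp only [boxTrunc, h0]
    have h3 : max (-R) (ψ t).im ≤ -c₀ := max_le (neg_le_neg hRc) (by linarith)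
    have h2 := (him _ (boxTrunc_re_nonpos hR0 (ψ t))).2 (by rw [h1]; linarith)
    refine h2.trans (mul_le_mul_of_nonneg_left ?_ hC₀)
    rw [h1]
    linarith [le_max_right (-R) (ψ t).im]
  have himB : ∀ t ∈ Icc 0 T, |(ψ t).im| ≤ B := fun t ht =>
    abs_le.2 ⟨by linarith [him2 t ht], him1 t ht⟩
  have hlow : ∀ t ∈ Icc 0 T, -(ψ t).re ≤ A := by
    have hrec : Continuous fun t => -(ψ t).re := (Complex.continuous_re.comp hψc).neg
    have := volterra_gronwall hK.integrableOn hK.nonneg hC₁ hμ hμ0 (mul_nonneg hC₁ hI0)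
      (d := fun t => -(ψ t).re) hrec.continuousOn (fun t ht => by linarith [hre0 t ht])
      (fun t ht => by
        have h1 : volterra K (fun s => -(G (ψ s)).re) t
            ≤ volterra K (fun s => C₁ * 1 + C₁ * -(ψ s).re) t := by
          refine volterra_mono hK.integrableOn hK.nonneg ht.1 hGre.neg.continuousOn
            (by fun_prop) fun s hs => ?_
          have hsT : s ∈ Icc 0 T := ⟨hs.1, hs.2.trans ht.2⟩
          have h2 := hre _ (boxTrunc_re_nonpos hR0 (ψ s))
            ((abs_boxTrunc_im_le hR0 (ψ s)).trans (himB s hsT))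
          have h3 := mul_le_mul_of_nonneg_left (le_boxTrunc_re (R := R) (hre0 s hsT)) hC₁
          change -(riccatiF b c ρ Λ ν w (boxTrunc R (ψ s))).re ≤ _
          linarith
        rw [hneg, ← hψre t ht, volterra_add hK.integrableOn ht.1 (by fun_prop) (by fun_prop),
          volterra_const_mul, volterra_const_mul] at h1
        have h4 := mul_le_mul_of_nonneg_left
          (volterra_one_mono hK.integrableOn hK.nonneg ht.1 ht.2) hC₁
        linarith)
    intro t ht
    refine (this t ht).trans (mul_le_mul_of_nonneg_left
      (Real.exp_le_exp.2 (mul_le_mul_of_nonneg_left ht.2 hμ0)) ?_)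
    positivity
  refine ⟨ψ, hψc.continuousOn, hre0, fun t ht => ?_⟩
  rw [hψ t ht]
  refine volterra_congr ht.1 fun s hs => ?_
  have hsT : s ∈ Icc 0 T := ⟨hs.1, hs.2.trans ht.2⟩
  simp only [hG]
  rw [boxTrunc_eq_self (by linarith [hlow s hsT]) (hre0 s hsT) ((himB s hsT).trans hRB)]

theorem exists_isRiccatiVolterraSolution (hF : RiccatiHypothesis c ρ Λ ν)
    (hK : VolterraKernel K) (b : ℝ) (hw : w.re ∈ Icc (0 : ℝ) 1) :
    ∃ ψ, IsRiccatiVolterraSolution b c ρ Λ ν K w ψ := by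
  choose Ψ hΨ using fun n : ℕ => exists_isRiccatiSolutionOn hF hK b hw (Nat.cast_nonneg n)
  -- The solutions on `[0, n]` agree on overlaps by uniqueness, so they glue.
  refine ⟨fun t => Ψ ⌈t⌉₊ t, isRiccatiVolterraSolution_iff.2 fun T => ?_⟩
  refine IsRiccatiSolutionOn.mono (T := (⌈T⌉₊ : ℝ)) ?_ (Nat.le_ceil T)
  refine (hΨ ⌈T⌉₊).congr fun t ht => ?_
  have hle : (⌈t⌉₊ : ℝ) ≤ ⌈T⌉₊ := Nat.cast_le.2 (Nat.ceil_le.2 ht.2)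
  exact IsRiccatiSolutionOn.unique hF hK hw.1 ((hΨ ⌈T⌉₊).mono hle) (hΨ ⌈t⌉₊)
    ⟨ht.1, Nat.le_ceil t⟩

theorem IsRiccatiVolterraSolution.unique (hF : RiccatiHypothesis c ρ Λ ν)
    (hK : VolterraKernel K) (hw : 0 ≤ w.re) {ψ φ : ℝ → ℂ}
    (hψ : IsRiccatiVolterraSolution b c ρ Λ ν K w ψ)
    (hφ : IsRiccatiVolterraSolution b c ρ Λ ν K w φ) : EqOn φ ψ (Ici 0) := fun t ht =>
  IsRiccatiSolutionOn.unique hF hK hw (isRiccatiVolterraSolution_iff.1 hψ t)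
    (isRiccatiVolterraSolution_iff.1 hφ t) ⟨ht, le_rfl⟩

theorem IsRiccatiVolterraSolution.conj {ψ : ℝ → ℂ}
    (hψ : IsRiccatiVolterraSolution b c ρ Λ ν K w ψ) :
    IsRiccatiVolterraSolution b c ρ Λ ν K (starRingEnd ℂ w) fun t => starRingEnd ℂ (ψ t) := by
  refine ⟨Complex.continuous_conj.comp_continuousOn hψ.continuousOn,
    fun t ht => by simpa using hψ.re_nonpos t ht, fun t ht => ?_⟩
  simp only [riccatiF_conj]
  rw [hψ.equation t ht, intervalIntegral.integral_of_le ht, intervalIntegral.integral_of_le ht,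
    ← integral_conj]
  simp

/-- The conjugate of `ψ` solves the same equation, hence equals `ψ`. -/
theorem IsRiccatiVolterraSolution.im_eq_zero (hF : RiccatiHypothesis c ρ Λ ν)
    (hK : VolterraKernel K) {x : ℝ} (hx : 0 ≤ x) {ψ : ℝ → ℂ}
    (hψ : IsRiccatiVolterraSolution b c ρ Λ ν K (x : ℂ) ψ) {t : ℝ} (ht : 0 ≤ t) :
    (ψ t).im = 0 := by
  have h1 := hψ.conj
  rw [Complex.conj_ofReal] at h1
  exact Complex.conj_eq_iff_im.1 (hψ.unique hF hK (by simpa using hx) h1 (mem_Ici.2 ht))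

/-- Comparison of the real part of a solution with the solution for the real part. -/
theorem IsRiccatiVolterraSolution.re_le_re (hF : RiccatiHypothesis c ρ Λ ν)
    (hK : VolterraKernel K) (hw : w.re ∈ Icc (0 : ℝ) 1) {ψ φ : ℝ → ℂ}
    (hψ : IsRiccatiVolterraSolution b c ρ Λ ν K w ψ)
    (hφ : IsRiccatiVolterraSolution b c ρ Λ ν K (w.re : ℂ) φ) {T : ℝ} (hT : 0 ≤ T) :
    (ψ T).re ≤ (φ T).re := by
  have hw' : 0 ≤ ((w.re : ℝ) : ℂ).re := hw.1
  have hψT := isRiccatiVolterraSolution_iff.1 hψ T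
  have hφT := isRiccatiVolterraSolution_iff.1 hφ T
  have hψr : ContinuousOn (fun t => (((ψ t).re : ℝ) : ℂ)) (Icc 0 T) :=
    (Complex.continuous_ofReal.comp Complex.continuous_re).comp_continuousOn hψT.continuousOn
  obtain ⟨M, hM, hL⟩ := hF.exists_lipschitz_along b hw' hφT.continuousOn hψr hφT.re_nonpos
    (fun t ht => by simpa using hψT.re_nonpos t ht)
  have hFψ := hF.continuousOn_comp b hw.1 hψT.continuousOn hψT.re_nonpos
  have hFφ := hF.continuousOn_comp b hw' hφT.continuousOn hφT.re_nonpos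
  set h : ℝ → ℝ := fun s => (riccatiF b c ρ Λ ν (w.re : ℂ) (φ s) - riccatiF b c ρ Λ ν w (ψ s)).re
    with hh
  have hhc : ContinuousOn h (Icc 0 T) := Complex.continuous_re.comp_continuousOn (hFφ.sub hFψ)
  have hv : ∀ t ∈ Icc 0 T, volterra K h t = (φ t).re - (ψ t).re := fun t ht => by
    have hsub : Icc 0 t ⊆ Icc 0 T := Icc_subset_Icc_right ht.2
    have h1 := volterra_clm Complex.reCLM hK.integrableOn ht.1
      (h := fun s => riccatiF b c ρ Λ ν (w.re : ℂ) (φ s) - riccatiF b c ρ Λ ν w (ψ s))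
      ((hFφ.sub hFψ).mono hsub)
    refine h1.trans ?_
    rw [volterra_sub hK.integrableOn ht.1 (hFφ.mono hsub) (hFψ.mono hsub),
      ← hφT.equation t ht, ← hψT.equation t ht]
    simp
  -- Where `φ ≤ Re ψ`, `Re F(w, ψ) ≤ F(Re w, Re ψ) ≤ F(Re w, φ) + M (Re ψ - φ)`. The last inequality
  -- uses that `φ` is real, so that the distance from `φ` to `Re ψ` is the difference of real parts.
  have := hK.neg_le_volterra le_rfl hM hhc (fun t ht hle => by
    rw [hv t ht] at hle ⊢
    have h1 := hF.re_le b hw.1 (hψT.re_nonpos t ht)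
    have h2 := (Complex.abs_re_le_norm _).trans (hL t ht t ht)
    have h3 : φ t - ((ψ t).re : ℂ) = (((φ t).re - (ψ t).re : ℝ) : ℂ) := by
      apply Complex.ext
      · simp
      · simpa using hφ.im_eq_zero hF hK hw.1 ht.1
    rw [h3, Complex.norm_real, Real.norm_eq_abs, abs_of_nonpos (a := (φ t).re - (ψ t).re) (by linarith),
      Complex.sub_re] at h2
    have h4 := (abs_le.1 h2).1
    simp only [hh, Complex.sub_re]
    linarith) T ⟨hT, le_rfl⟩
  rw [hv T ⟨hT, le_rfl⟩] at this
  linarith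

end Solutions

theorem theorem3p1 (b c ρ Λ : ℝ) (hc : 0 < c) (hρ : ρ ∈ Set.Icc (-1 : ℝ) 1) (hΛ : 0 ≤ Λ)
    (ν : MeasureTheory.Measure ℝ) (hν_supp : ν (Set.Iic 0) = 0)
    (hν_sq : MeasureTheory.Integrable (fun z : ℝ => z ^ 2) ν)
    (K : ℝ → ℝ) (hK : KernelHypothesis K)
    (w : ℂ) (hw : w.re ∈ Set.Icc (0 : ℝ) 1) :
    ∃ ψ ψr : ℝ → ℂ,
      -- existence and uniqueness of `ψ_w` on `ℝ₊`
      (IsRiccatiVolterraSolution b c ρ Λ ν K w ψ ∧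
        ∀ φ : ℝ → ℂ, IsRiccatiVolterraSolution b c ρ Λ ν K w φ → Set.EqOn φ ψ (Set.Ici 0)) ∧
      -- existence and uniqueness of `ψ_{Re w}` on `ℝ₊`
      (IsRiccatiVolterraSolution b c ρ Λ ν K (w.re : ℂ) ψr ∧
        ∀ φ : ℝ → ℂ, IsRiccatiVolterraSolution b c ρ Λ ν K (w.re : ℂ) φ →
          Set.EqOn φ ψr (Set.Ici 0)) ∧
      -- `ψ_{Re w}` is real-valued
      (∀ t : ℝ, 0 ≤ t → (ψr t).im = 0) ∧
      -- comparison
      (∀ t : ℝ, 0 ≤ t → (ψ t).re ≤ (ψr t).re ∧ (ψr t).re ≤ 0) := by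
  have hF : RiccatiHypothesis c ρ Λ ν := ⟨hc, hρ, hΛ, hν_supp, hν_sq⟩
  have hK' := hK.volterraKernel
  obtain ⟨ψ, hψ⟩ := exists_isRiccatiVolterraSolution hF hK' b hw
  obtain ⟨ψr, hψr⟩ := exists_isRiccatiVolterraSolution hF hK' b
    (w := (w.re : ℂ)) (by simpa using hw)
  exact ⟨ψ, ψr, ⟨hψ, fun φ hφ => hψ.unique hF hK' hw.1 hφ⟩,
    ⟨hψr, fun φ hφ => hψr.unique hF hK' (by simpa using hw.1) hφ⟩,
    fun t ht => hψr.im_eq_zero hF hK' hw.1 ht,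
    fun t ht => ⟨hψ.re_le_re hF hK' hw hψr ht, hψr.re_nonpos t ht⟩⟩
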